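/- **Definitions.** A *linear forest* is an acyclic graph of maximum degree at most $2$. The problem *$q$-Coloring on Linear Forest$+kv$ graphs* is the following parameterized problem: the input is a finite simple graph $G$ together with a set $X\subseteq V(G)$ (a *modulator*) such that $G-X$ is a linear forest; the parameter is $k=|X|$; the question is whether the vertices of $G$ can be coloured with $q$ colours such that adjacent vertices get different colours. For $s\in\mathbb N$, *$s$-SAT* is the problem of deciding whether a given Boolean formula in conjunctive normal form on $n$ variables, with at most $s$ literals per clause, is satisfiable; its parameter is $n$. A problem with parameter $k$ is *solvable in time $\mathcal O^*(b^k)$* if there are a deterministic algorithm (multi-tape Turing machine) and constants $C,c$ such that the algorithm decides every instance correctly in at most $C\cdot b^k\cdot N^c$ steps, where $k$ is the parameter and $N$ the encoding length of the instance. The *Strong Exponential-Time Hypothesis* (SETH) states that for every $\varepsilon>0$ there is a constant $s$ such that $s$-SAT on $n$ variables is not solvable in time $\mathcal O^*((2-\varepsilon)^n)$. **Theorem.** Assume SETH. Then for every integer $q\ge 3$ and every real $\varepsilon>0$, $q$-Coloring on Linear Forest$+kv$ graphs is not solvable in time $\mathcal O^*((q-\varepsilon)^k)$. -/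

import Mathlib

/-! ## Problems, machines, running times -/

/-- A (parameterized, possibly promise) decision problem: a type of instances, an encoding of the
instances as input words over the binary alphabet, the parameter of an instance, and the set of
yes-instances. -/
structure ParamProblem where
  /-- the instances -/
  Inst : Type
  /-- the input word of an instance -/
  encode : Inst → List Bool
  /-- the parameter of an instance -/
  param : Inst → ℕ
  /-- the yes-instances -/
  yes : Inst → Prop

open Classical in
/-- `P.SolvableInOStar b`: the problem `P` can be solved in time `O*(b ^ k)`, where `k` is the
parameter. That is, there is one deterministic multi-stack Turing machine that, started on the
input word of any instance `x`, halts with the correct one-bit answer, after a number of steps that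
is at most `C * b ^ k * N ^ c`, where `N` is the length of the input word and `C`, `c` are constants
which do not depend on `x`. -/
def ParamProblem.SolvableInOStar (P : ParamProblem) (b : ℝ) : Prop :=
  ∃ (M : Turing.TM2ComputableAux Bool Bool) (C c : ℕ), ∀ x : P.Inst, ∃ t : ℕ,
    (t : ℝ) ≤ C * b ^ P.param x * ((P.encode x).length : ℝ) ^ c ∧
    Nonempty (Turing.TM2OutputsInTime M.tm
      ((P.encode x).map M.inputAlphabet.invFun)
      (some ([decide (P.yes x)].map M.outputAlphabet.invFun)) t)

/-! ## Encodings

Numbers that name a variable or a vertex are written in unary. They are smaller than the number of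
variables or vertices of the instance, so this changes input lengths only polynomially. -/

/-- A natural number in unary, self-delimiting: `n` ones and a zero. -/
def unaryWord (n : ℕ) : List Bool := List.replicate n true ++ [false]

/-- A list, self-delimiting: each entry is announced by a one, the end of the list by a zero. -/
def listWord {α : Type} (enc : α → List Bool) (L : List α) : List Bool :=
  L.flatMap (fun a => true :: enc a) ++ [false]

/-! ## `s`-SAT and the Strong Exponential-Time Hypothesis -/

/-- A Boolean formula in conjunctive normal form on the variables `0, …, n - 1`, all of whose
clauses have at most `s` literals. The literal `(i, true)` is the variable `i`, and `(i, false)`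
is its negation. -/
structure BoundedCNF (s : ℕ) where
  /-- the number of variables -/
  n : ℕ
  /-- the clauses -/
  clauses : List (List (Fin n × Bool))
  size_le : ∀ C ∈ clauses, C.length ≤ s

/-- Some truth assignment makes at least one literal of every clause true. -/
def BoundedCNF.Satisfiable {s : ℕ} (φ : BoundedCNF s) : Prop :=
  ∃ a : Fin φ.n → Bool, ∀ C ∈ φ.clauses, ∃ l ∈ C, a l.1 = l.2

/-- The input word of a formula: the number of variables, then the list of clauses. -/
def BoundedCNF.encode {s : ℕ} (φ : BoundedCNF s) : List Bool :=
  unaryWord φ.n ++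
    listWord (listWord fun l : Fin φ.n × Bool => unaryWord l.1 ++ [l.2]) φ.clauses

/-- `s`-SAT, parameterized by the number of variables. -/
def satProblem (s : ℕ) : ParamProblem where
  Inst := BoundedCNF s
  encode := BoundedCNF.encode
  param := BoundedCNF.n
  yes := BoundedCNF.Satisfiable

/-- The Strong Exponential-Time Hypothesis: for every `ε > 0` there is a constant `s` such that
`s`-SAT on `n` variables cannot be solved in time `O*((2 - ε) ^ n)`. -/
def SETH : Prop :=
  ∀ ε : ℝ, 0 < ε → ∃ s : ℕ, ¬ (satProblem s).SolvableInOStar (2 - ε)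

/-! ## `q`-Coloring on `F + kv` graphs -/

/-- A linear forest: an acyclic graph of maximum degree at most two. -/
def IsLinearForest (V : Type) (G : SimpleGraph V) : Prop :=
  G.IsAcyclic ∧ ∀ v : V, (G.neighborSet v).encard ≤ 2

/-- An instance of a problem on `F + kv` graphs, for a graph class `F`: a finite simple graph `G`,
presented by its number of vertices and a list of its edges (in any order, each edge in any
orientation), together with a modulator `X` to `F`, that is, a vertex set with `G - X ∈ F`. -/
structure KvInstance (F : (V : Type) → SimpleGraph V → Prop) where
  /-- the number of vertices -/
  n : ℕ
  /-- the graph -/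
  G : SimpleGraph (Fin n)
  /-- the list of edges -/
  edges : List (Fin n × Fin n)
  adj_iff : ∀ u v : Fin n, G.Adj u v ↔ (u, v) ∈ edges ∨ (v, u) ∈ edges
  /-- the modulator -/
  X : Finset (Fin n)
  modulator : F _ (G.induce {v : Fin n | v ∉ X})

/-- The input word: the number of vertices, the list of edges, and the characteristic vector of
the modulator. -/
def KvInstance.encode {F : (V : Type) → SimpleGraph V → Prop} (I : KvInstance F) : List Bool :=
  unaryWord I.n ++
    listWord (fun e : Fin I.n × Fin I.n => unaryWord e.1 ++ unaryWord e.2) I.edges ++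
    List.ofFn fun v : Fin I.n => decide (v ∈ I.X)

/-- `q`-Coloring on `F + kv` graphs, parameterized by the size `k` of the given modulator. -/
def coloringProblem (F : (V : Type) → SimpleGraph V → Prop) (q : ℕ) : ParamProblem where
  Inst := KvInstance F
  encode := KvInstance.encode
  param := fun I => I.X.card
  yes := fun I => I.G.Colorable q

/-!
# Coloring graphs that are `k` vertices away from a linear forest

A machine for `q`-Coloring that runs in time `O*(b ^ k)` with `b < q` is turned into machines for all
problems `s`-SAT that run in time `O*(β ^ n)` for one `β < 2`, against SETH.

**Encoding of assignments.** Choose `t` and `p` with `b ^ t < 2 ^ p ≤ q ^ t` (`exists_block_size`).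
Since `2 ^ p ≤ q ^ t`, the colourings of `t` vertices can encode, through a surjection `D`, all
assignments of `p` variables. The modulator consists of `t` vertices for each group of `p` variables,
and of a clique of `q` palette vertices, which stand for the colours. It has about `t * n / p`
vertices, and `b ^ (t * n / p) = β ^ n` where `β ^ p = b ^ t < 2 ^ p`.

**Clauses.** A clause excludes a bounded number of colourings of the groups of its literals. For each
of them there is a path, joined to the modulator, which can be coloured unless the excluded colouring
is present (`PathVertex.extends_path_iff`). Such a path transmits a state from left to right, which
is `0` at the start and has to be `1` at the end. It consists of blocks, one for each vertex of the
excluded colouring, and the state can change from `0` to `1` in a block exactly if the vertex does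
not have its excluded colour. Lists of allowed colours are enforced by edges to the palette. Without
the modulator only paths are left, and the graph is `q`-colourable if and only if the formula is
satisfiable (`BoundedCNF.kvInstance_colorable_iff`).

**Machines.** The reduction is written as a program in a small language of loops and branches on
stacks of bits (`StackProg`). Such a program compiles to multi-stack Turing machine code that takes
the same number of steps (`StackProg.Exec.iterStep_code`), and it can be followed by a given machine
(`StackProg.thenMachine`), so a program that runs in quadratic time carries time bounds from one
problem to another (`StackProg.solvableInOStar_of_runs`). The program reads each clause into a
bounded number of unary registers and then writes the edges of its paths, which depend on the
registers in one of finitely many ways (`StackProg.runs_reduction`).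
-/

/-! ### Programs over Boolean stacks -/

/-- Programs that act on finitely many stacks of bits, indexed by `K`, and on a control value in
the finite type `X`. -/
inductive StackProg (K X : Type) : Type
  /-- push a fixed bit -/
  | push (k : K) (b : Bool) : StackProg K X
  /-- change the control value -/
  | upd (f : X → X) : StackProg K X
  /-- run two programs one after the other -/
  | seq (c d : StackProg K X) : StackProg K X
  /-- branch on the control value -/
  | switch (c : X → StackProg K X) : StackProg K X
  /-- pop a stack and branch on the popped symbol (`none` if the stack is empty) -/
  | popCase (k : K) (c : Option Bool → StackProg K X) : StackProg K X
  /-- pop a stack; stop if `go` rejects the popped symbol, else run the body and repeat -/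
  | loop (k : K) (go : Option Bool → Bool) (c : Option Bool → StackProg K X) : StackProg K X

namespace StackProg

open Turing Function

variable {K X : Type}

/-- The store of a program: the control value and the stacks. -/
abbrev Store (K X : Type) : Type := X × (K → List Bool)

/-- `Exec c s s' t`: started in the store `s`, the program `c` stops in the store `s'` after exactly
`t` machine steps. -/
inductive Exec [DecidableEq K] : StackProg K X → Store K X → Store K X → ℕ → Prop
  | push (k b) (s : Store K X) : Exec (push k b) s (s.1, update s.2 k (b :: s.2 k)) 1
  | upd (f) (s : Store K X) : Exec (upd f) s (f s.1, s.2) 1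
  | seq {c d s₁ s₂ s₃ t u} : Exec c s₁ s₂ t → Exec d s₂ s₃ u → Exec (seq c d) s₁ s₃ (t + u)
  | switch {c} {s s' : Store K X} {t} : Exec (c s.1) s s' t → Exec (switch c) s s' (t + 1)
  | popCase {k c} {s s' : Store K X} {t} :
      Exec (c (s.2 k).head?) (s.1, update s.2 k (s.2 k).tail) s' t →
        Exec (popCase k c) s s' (t + 1)
  | loop_exit {k go c} {s : Store K X} : go (s.2 k).head? = false →
      Exec (loop k go c) s (s.1, update s.2 k (s.2 k).tail) 1
  | loop_step {k go c} {s s₂ s₃ : Store K X} {t u} : go (s.2 k).head? = true →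
      Exec (c (s.2 k).head?) (s.1, update s.2 k (s.2 k).tail) s₂ t →
        Exec (loop k go c) s₂ s₃ u → Exec (loop k go c) s s₃ (t + 1 + u)

/-- Each step pushes at most one bit. -/
theorem Exec.length_le [DecidableEq K] {c : StackProg K X} {s s' : Store K X} {t : ℕ}
    (h : Exec c s s' t) (j : K) : (s'.2 j).length ≤ (s.2 j).length + t := by
  have pop (s : Store K X) (k : K) :
      (update s.2 k (s.2 k).tail j).length ≤ (s.2 j).length := by
    by_cases hj : j = k
    · subst hj; simp
    · simp [hj]
  induction h with
  | push k b s =>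
    by_cases hj : j = k
    · subst hj; simp
    · simp [hj]
  | upd f s => simp
  | seq _ _ h₁ h₂ => omega
  | switch _ h₁ => omega
  | @popCase k c s s' t _ h₁ =>
    have := pop s k; simp only at h₁; omega
  | loop_exit _ => exact (pop _ _).trans (by omega)
  | @loop_step k go c s s₂ s₃ t u hg _ _ h₁ h₂ =>
    have := pop s k; simp only at h₁; omega

/-- The labels of the machine code of a program: one for each of its commands. -/
def Lbl : StackProg K X → Type
  | push _ _ => Unit
  | upd _ => Unit
  | seq c d => Lbl c ⊕ Lbl d
  | switch c => Option (Σ x, Lbl (c x))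
  | popCase _ c => Option (Σ o, Lbl (c o))
  | loop _ _ c => Option (Σ o, Lbl (c o))

/-- The label at which a program is entered. -/
def start : (c : StackProg K X) → Lbl c
  | push _ _ => ()
  | upd _ => ()
  | seq c _ => .inl (start c)
  | switch _ => none
  | popCase _ _ => none
  | loop _ _ _ => none

instance finite_Lbl [Finite X] : (c : StackProg K X) → Finite (Lbl c)
  | push _ _ => inferInstanceAs (Finite Unit)
  | upd _ => inferInstanceAs (Finite Unit)
  | seq c d =>
    have := finite_Lbl c
    have := finite_Lbl d
    inferInstanceAs (Finite (Lbl c ⊕ Lbl d))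
  | switch c =>
    have := fun x => finite_Lbl (c x)
    inferInstanceAs (Finite (Option (Σ x, Lbl (c x))))
  | popCase _ c =>
    have := fun x => finite_Lbl (c x)
    inferInstanceAs (Finite (Option (Σ x, Lbl (c x))))
  | loop _ _ c =>
    have := fun x => finite_Lbl (c x)
    inferInstanceAs (Finite (Option (Σ x, Lbl (c x))))

section Compile

variable {K₀ Λ σ : Type} {Γ : K₀ → Type}

/-- The stack alphabets of a machine extended by Boolean stacks indexed by `K`. -/
@[reducible] def ExtAlphabet (K : Type) (Γ : K₀ → Type) : K₀ ⊕ K → Type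
  | .inl k => Γ k
  | .inr _ => Bool

/-- The stacks of an extended machine. -/
def joinStk (A : ∀ k, List (Γ k)) (S : K → List Bool) : ∀ k, List (ExtAlphabet K Γ k)
  | .inl k => A k
  | .inr k => S k

@[simp] theorem joinStk_inl (A : ∀ k, List (Γ k)) (S : K → List Bool) (k : K₀) :
    joinStk A S (.inl k) = A k := rfl

@[simp] theorem joinStk_inr (A : ∀ k, List (Γ k)) (S : K → List Bool) (k : K) :
    joinStk A S (.inr k) = S k := rfl

theorem joinStk_nil :
    (joinStk (fun _ => []) (fun _ => []) : ∀ k, List (ExtAlphabet K Γ k)) = fun _ => [] := by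
  funext k; cases k <;> rfl

theorem update_joinStk_inr [DecidableEq K₀] [DecidableEq K] (A : ∀ k, List (Γ k))
    (S : K → List Bool) (k : K) (l : List Bool) :
    update (joinStk A S) (.inr k) l = joinStk A (update S k l) := by
  funext j
  rcases j with j | j
  · rw [update_of_ne (by simp)]; rfl
  · by_cases h : j = k
    · subst h; simp [joinStk]
    · rw [update_of_ne (by simpa using h)]; simp [joinStk, h]

theorem update_joinStk_inl [DecidableEq K₀] [DecidableEq K] (A : ∀ k, List (Γ k))
    (S : K → List Bool) (k : K₀) (l : List (Γ k)) :
    update (joinStk A S) (.inl k) l = joinStk (update A k l) S := by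
  funext j
  rcases j with j | j
  · by_cases h : j = k
    · subst h; simp [joinStk]
    · rw [update_of_ne (by simpa using h)]; simp [joinStk, h]
  · rw [update_of_ne (by simp)]; rfl

/-- The machine code of a program, for a machine whose labels contain those of the program via
`emb`, and which is to continue at the label `exit`. The internal state of the machine has a part
that the program does not touch, the control value, and the symbol that was popped last. -/
def code : (c : StackProg K X) → (Lbl c → Λ) → Λ → Lbl c →
    TM2.Stmt (ExtAlphabet K Γ) Λ (σ × X × Option Bool)
  | push k b, _, exit => fun _ => .push (.inr k) (fun _ => b) (.goto fun _ => exit)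
  | upd f, _, exit => fun _ => .load (fun v => (v.1, f v.2.1, v.2.2)) (.goto fun _ => exit)
  | seq c d, emb, exit => Sum.rec
      (code c (fun l => emb (.inl l)) (emb (.inr (start d))))
      (code d (fun l => emb (.inr l)) exit)
  | switch c, emb, exit => Option.rec
      (.goto fun v => emb (some ⟨v.2.1, start (c v.2.1)⟩))
      (fun l => code (c l.1) (fun l' => emb (some ⟨l.1, l'⟩)) exit l.2)
  | popCase k c, emb, exit => Option.rec
      (.pop (.inr k) (fun v o => (v.1, v.2.1, o))
        (.goto fun v => emb (some ⟨v.2.2, start (c v.2.2)⟩)))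
      (fun l => code (c l.1) (fun l' => emb (some ⟨l.1, l'⟩)) exit l.2)
  | loop k go c, emb, exit => Option.rec
      (.pop (.inr k) (fun v o => (v.1, v.2.1, o))
        (.goto fun v => if go v.2.2 then emb (some ⟨v.2.2, start (c v.2.2)⟩) else exit))
      (fun l => code (c l.1) (fun l' => emb (some ⟨l.1, l'⟩)) (emb none) l.2)

variable [DecidableEq K₀] [DecidableEq K]

/-- `t` steps of a machine; `none` stands for having halted earlier. -/
def iterStep {J : Type} [DecidableEq J] {Δ : J → Type} (m : Λ → TM2.Stmt Δ Λ σ) (t : ℕ) :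
    Option (TM2.Cfg Δ Λ σ) → Option (TM2.Cfg Δ Λ σ) :=
  (flip Option.bind (TM2.step m))^[t]

theorem iterStep_succ {J : Type} [DecidableEq J] {Δ : J → Type} (m : Λ → TM2.Stmt Δ Λ σ) (t : ℕ)
    (l : Λ) (v : σ) (S : ∀ j, List (Δ j)) :
    iterStep m (t + 1) (some ⟨some l, v, S⟩) = iterStep m t (some (TM2.stepAux (m l) v S)) := rfl

theorem iterStep_add {J : Type} [DecidableEq J] {Δ : J → Type} (m : Λ → TM2.Stmt Δ Λ σ) (t u : ℕ)
    (C : Option (TM2.Cfg Δ Λ σ)) : iterStep m (t + u) C = iterStep m u (iterStep m t C) := by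
  rw [iterStep, Nat.add_comm, iterate_add_apply]; rfl

/-- The machine code of a program does what the program does, in the same number of steps. -/
theorem Exec.iterStep_code {c : StackProg K X} {s s' : Store K X} {t : ℕ} (h : Exec c s s' t)
    (m : Λ → TM2.Stmt (ExtAlphabet K Γ) Λ (σ × X × Option Bool)) (v : σ) (A : ∀ k, List (Γ k)) :
    ∀ (emb : Lbl c → Λ) (exit : Λ), (∀ l, m (emb l) = code c emb exit l) → ∀ o : Option Bool,
      ∃ o', iterStep m t (some ⟨some (emb c.start), (v, s.1, o), joinStk A s.2⟩) =
        some ⟨some exit, (v, s'.1, o'), joinStk A s'.2⟩ := by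
  induction h with
  | push k b s =>
    intro emb exit hm o
    refine ⟨o, ?_⟩
    rw [iterStep_succ, hm]
    change some (⟨some exit, _, update (joinStk A s.2) (.inr k) (b :: s.2 k)⟩ :
      TM2.Cfg (ExtAlphabet K Γ) Λ (σ × X × Option Bool)) = _
    rw [update_joinStk_inr]
  | upd f s =>
    intro emb exit hm o
    refine ⟨o, ?_⟩
    rw [iterStep_succ, hm]
    rfl
  | seq _ _ h₁ h₂ =>
    intro emb exit hm o
    obtain ⟨o₁, e₁⟩ := h₁ _ _ (fun l => hm (.inl l)) o
    obtain ⟨o₂, e₂⟩ := h₂ _ _ (fun l => hm (.inr l)) o₁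
    refine ⟨o₂, ?_⟩
    rw [iterStep_add]
    exact (congrArg _ e₁).trans e₂
  | @switch c s s' t _ h₁ =>
    intro emb exit hm o
    obtain ⟨o₁, e₁⟩ := h₁ _ _ (fun l => hm (some ⟨_, l⟩)) o
    refine ⟨o₁, ?_⟩
    rw [iterStep_succ, hm]
    exact e₁
  | @popCase k c s s' t _ h₁ =>
    intro emb exit hm o
    obtain ⟨o₁, e₁⟩ := h₁ _ _ (fun l => hm (some ⟨_, l⟩)) (s.2 k).head?
    refine ⟨o₁, ?_⟩
    rw [← update_joinStk_inr] at e₁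
    rw [iterStep_succ, hm]
    exact e₁
  | @loop_exit k go c s hg =>
    intro emb exit hm o
    refine ⟨(s.2 k).head?, ?_⟩
    rw [iterStep_succ, hm, ← update_joinStk_inr]
    change some (⟨some (if go (s.2 k).head? then _ else exit), _, _⟩ :
      TM2.Cfg (ExtAlphabet K Γ) Λ (σ × X × Option Bool)) = _
    rw [hg]
    rfl
  | @loop_step k go c s s₂ s₃ t u hg _ _ h₁ h₂ =>
    intro emb exit hm o
    obtain ⟨o₁, e₁⟩ := h₁ _ _ (fun l => hm (some ⟨_, l⟩)) (s.2 k).head?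
    obtain ⟨o₂, e₂⟩ := h₂ _ _ hm o₁
    refine ⟨o₂, ?_⟩
    rw [← update_joinStk_inr] at e₁
    rw [iterStep_add, iterStep_succ, hm]
    refine (congrArg _ (Eq.trans ?_ e₁)).trans e₂
    change iterStep m t (some (⟨some (if go (s.2 k).head? then
      emb (some ⟨(s.2 k).head?, (c (s.2 k).head?).start⟩) else exit), _, _⟩ :
      TM2.Cfg (ExtAlphabet K Γ) Λ (σ × X × Option Bool))) = _
    rw [hg]
    rfl

end Compile

end StackProg

/-! ### Running a machine on the output of a program -/

namespace StackProg

open Turing Function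

variable {K X : Type}

section Lift

variable {K₀ Λ σ : Type} {Γ : K₀ → Type}

/-- A machine statement, read as a statement of a machine with more stacks, labels and internal
state. -/
def liftStmt (K L τ : Type) : TM2.Stmt Γ Λ σ → TM2.Stmt (ExtAlphabet K Γ) (Λ ⊕ L) (σ × τ)
  | .push k f q => .push (.inl k) (fun v => f v.1) (liftStmt K L τ q)
  | .peek k f q => .peek (.inl k) (fun v o => (f v.1 o, v.2)) (liftStmt K L τ q)
  | .pop k f q => .pop (.inl k) (fun v o => (f v.1 o, v.2)) (liftStmt K L τ q)
  | .load f q => .load (fun v => (f v.1, v.2)) (liftStmt K L τ q)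
  | .branch f q₁ q₂ => .branch (fun v => f v.1) (liftStmt K L τ q₁) (liftStmt K L τ q₂)
  | .goto f => .goto fun v => .inl (f v.1)
  | .halt => .halt

/-- A configuration, read as a configuration of the larger machine. -/
def liftCfg (L : Type) {τ : Type} (w : τ) (S : K → List Bool) (C : TM2.Cfg Γ Λ σ) :
    TM2.Cfg (ExtAlphabet K Γ) (Λ ⊕ L) (σ × τ) :=
  ⟨C.l.map .inl, (C.var, w), joinStk C.stk S⟩

variable [DecidableEq K₀] [DecidableEq K] {L τ : Type}

theorem stepAux_liftStmt (w : τ) (S : K → List Bool) (q : TM2.Stmt Γ Λ σ) (v : σ)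
    (A : ∀ k, List (Γ k)) :
    TM2.stepAux (liftStmt K L τ q) (v, w) (joinStk A S) = liftCfg L w S (TM2.stepAux q v A) := by
  induction q generalizing v A with
  | push k f q ih =>
    rw [TM2.stepAux.eq_1, ← ih, ← update_joinStk_inl]; rfl
  | peek k f q ih => exact ih _ _
  | pop k f q ih =>
    rw [TM2.stepAux.eq_3, ← ih, ← update_joinStk_inl]; rfl
  | load f q ih => exact ih _ _
  | branch f q₁ q₂ ih₁ ih₂ =>
    rw [TM2.stepAux.eq_5, liftStmt, TM2.stepAux.eq_5, ih₁, ih₂]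
    cases f v <;> rfl
  | goto f => rfl
  | halt => rfl

theorem iterStep_liftCfg (m : Λ → TM2.Stmt Γ Λ σ)
    (m' : Λ ⊕ L → TM2.Stmt (ExtAlphabet K Γ) (Λ ⊕ L) (σ × τ))
    (hm : ∀ l, m' (.inl l) = liftStmt K L τ (m l)) (w : τ) (S : K → List Bool) (t : ℕ)
    (C : Option (TM2.Cfg Γ Λ σ)) :
    iterStep m' t (C.map (liftCfg L w S)) = (iterStep m t C).map (liftCfg L w S) := by
  induction t generalizing C with
  | zero => rfl
  | succ t ih =>
    have step : (C.map (liftCfg L w S)).bind (TM2.step m') =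
        (C.bind (TM2.step m)).map (liftCfg L w S) := by
      rcases C with _ | ⟨_ | l, v, A⟩
      · rfl
      · rfl
      · refine congrArg some ?_
        change TM2.stepAux (m' (.inl l)) (v, w) (joinStk A S) = _
        rw [hm, stepAux_liftStmt]
    exact (congrArg (iterStep m' t) step).trans (ih _)

end Lift

theorem initList_eq (tm : FinTM2) (l : List (tm.Γ tm.k₀)) :
    initList tm l = ⟨some tm.main, tm.initialState, update (fun _ => []) tm.k₀ l⟩ := by
  refine congrArg (TM2.Cfg.mk (Γ := tm.Γ) (Λ := tm.Λ) _ _) (funext fun k => ?_)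
  by_cases h : k = tm.k₀
  · subst h; simp
  · simp [h]

theorem haltList_eq (tm : FinTM2) (l : List (tm.Γ tm.k₁)) :
    haltList tm l = ⟨none, tm.initialState, update (fun _ => []) tm.k₁ l⟩ := by
  refine congrArg (TM2.Cfg.mk (Γ := tm.Γ) (Λ := tm.Λ) _ _) (funext fun k => ?_)
  by_cases h : k = tm.k₁
  · subst h; simp
  · simp [h]

variable [DecidableEq K]

/-- The store in which one stack holds the given word and all others are empty. -/
def single (x : X) (k : K) (w : List Bool) : Store K X := (x, update (fun _ => []) k w)

/-- The transition table of the machine that runs the program `c`, pours the stack `out` onto the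
input stack of `M`, and then runs `M`. -/
def thenCode (c : StackProg K X) (out : K) (M : TM2ComputableAux Bool Bool) :
    M.tm.Λ ⊕ Option c.Lbl → TM2.Stmt (ExtAlphabet K M.tm.Γ) (M.tm.Λ ⊕ Option c.Lbl)
      (M.tm.σ × X × Option Bool)
  | .inl l => liftStmt K _ _ (M.tm.m l)
  | .inr none => .pop (.inr out) (fun v o => (v.1, v.2.1, o)) <| .branch (fun v => v.2.2.isSome)
      (.push (.inl M.tm.k₀) (fun v => M.inputAlphabet.invFun (v.2.2.getD false))
        (.goto fun _ => .inr none))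
      (.goto fun _ => .inl M.tm.main)
  | .inr (some l) => code c (fun l => .inr (some l)) (.inr none) l

/-- The machine that runs the program `c`, pours the stack `out` onto the input stack of `M`, and
then runs `M`. -/
noncomputable def thenMachine [Fintype K] [Fintype X] (c : StackProg K X) (inp out : K) (x₀ : X)
    (M : TM2ComputableAux Bool Bool) : TM2ComputableAux Bool Bool where
  tm :=
    { K := M.tm.K ⊕ K
      kFin := letI := M.tm.kFin; inferInstance
      k₀ := .inr inp
      k₁ := .inl M.tm.k₁
      Γ := ExtAlphabet K M.tm.Γ
      Λ := M.tm.Λ ⊕ Option c.Lbl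
      main := .inr (some c.start)
      ΛFin := letI := M.tm.ΛFin; letI := Fintype.ofFinite c.Lbl; inferInstance
      σ := M.tm.σ × X × Option Bool
      initialState := (M.tm.initialState, x₀, none)
      σFin := letI := M.tm.σFin; inferInstance
      Γk₀Fin := inferInstanceAs (Fintype Bool)
      m := thenCode c out M }
  inputAlphabet := Equiv.refl Bool
  outputAlphabet := M.outputAlphabet

theorem stepAux_pour_nil (c : StackProg K X) (out : K) (M : TM2ComputableAux Bool Bool)
    (v : M.tm.σ) (x : X) (o : Option Bool) (A : ∀ k, List (M.tm.Γ k)) (S : K → List Bool)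
    (hS : S out = []) :
    TM2.stepAux (thenCode c out M (.inr none)) (v, x, o) (joinStk A S) =
      ⟨some (.inl M.tm.main), (v, x, none), joinStk A S⟩ := by
  simp only [thenCode, TM2.stepAux, joinStk_inr, hS]
  refine congrArg (TM2.Cfg.mk _ _) ?_
  rw [← joinStk_inr A S] at hS
  exact update_eq_self_iff.2 hS.symm

theorem stepAux_pour_cons (c : StackProg K X) (out : K) (M : TM2ComputableAux Bool Bool)
    (v : M.tm.σ) (x : X) (o : Option Bool) (A : ∀ k, List (M.tm.Γ k)) (S : K → List Bool)
    (b : Bool) (w : List Bool) (hS : S out = b :: w) :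
    TM2.stepAux (thenCode c out M (.inr none)) (v, x, o) (joinStk A S) =
      ⟨some (.inr none), (v, x, some b),
        joinStk (update A M.tm.k₀ (M.inputAlphabet.invFun b :: A M.tm.k₀)) (update S out w)⟩ := by
  simp only [thenCode, TM2.stepAux, joinStk_inr, hS]
  refine congrArg (TM2.Cfg.mk _ _) ?_
  rw [← update_joinStk_inl, ← update_joinStk_inr]
  rfl

/-- The pouring phase: it reverses the word. -/
theorem iterStep_pour (c : StackProg K X) (out : K) (M : TM2ComputableAux Bool Bool) (w : List Bool)
    (l : List (M.tm.Γ M.tm.k₀)) (v : M.tm.σ) (x : X) (o : Option Bool) :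
    iterStep (thenCode c out M) (w.length + 1)
      (some ⟨some (.inr none), (v, x, o), joinStk (update (fun _ => []) M.tm.k₀ l)
        (update (fun _ => []) out w)⟩) =
      some ⟨some (.inl M.tm.main), (v, x, none),
        joinStk (update (fun _ => []) M.tm.k₀ (w.reverse.map M.inputAlphabet.invFun ++ l))
          fun _ => []⟩ := by
  induction w generalizing l o with
  | nil =>
    have : update (fun _ : K => ([] : List Bool)) out [] = fun _ => [] :=
      update_eq_self_iff.2 rfl
    rw [iterStep_succ, stepAux_pour_nil _ _ _ _ _ _ _ _ (update_self _ _ _), this]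
    rfl
  | cons b w ih =>
    rw [List.length_cons, iterStep_succ, stepAux_pour_cons _ _ _ _ _ _ _ _ _ _ (update_self _ _ _),
      update_idem, update_idem, update_self, ih]
    simp

theorem thenMachine_outputs [Fintype K] [Fintype X] {c : StackProg K X} {inp out : K} {x₀ : X}
    {M : TM2ComputableAux Bool Bool} {w w' r : List Bool} {t u : ℕ}
    (h : Exec c (single x₀ inp w) (single x₀ out w'.reverse) t)
    (hM : Nonempty (TM2OutputsInTime M.tm (w'.map M.inputAlphabet.invFun)
      (some (r.map M.outputAlphabet.invFun)) u)) :
    Nonempty (TM2OutputsInTime (thenMachine c inp out x₀ M).tm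
      (w.map (thenMachine c inp out x₀ M).inputAlphabet.invFun)
      (some (r.map (thenMachine c inp out x₀ M).outputAlphabet.invFun))
      (t + (w'.length + 1) + u)) := by
  obtain ⟨⟨⟨n, hn⟩, hnu⟩⟩ := hM
  change n ≤ u at hnu
  change iterStep M.tm.m n _ = _ at hn
  obtain ⟨o, ho⟩ := h.iterStep_code (thenCode c out M) M.tm.initialState
    (fun _ => []) (fun l => .inr (some l)) (.inr none) (fun _ => rfl) none
  have hp := iterStep_pour c out M w'.reverse [] M.tm.initialState x₀ o
  rw [List.length_reverse, update_eq_self_iff.2 rfl] at hp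
  have hn' := (congrArg (fun C => iterStep M.tm.m n (some C)) (initList_eq M.tm _)).symm.trans
    (hn.trans (congrArg some (haltList_eq M.tm _)))
  have hl := iterStep_liftCfg (K := K) M.tm.m (thenCode c out M) (fun _ => rfl)
    (x₀, none) (fun _ => []) n (some ⟨some M.tm.main, M.tm.initialState,
      update (fun _ => []) M.tm.k₀ (w'.map M.inputAlphabet.invFun)⟩)
  rw [hn'] at hl
  have main : iterStep (thenCode c out M) (t + (w'.length + 1) + n)
      (some ⟨some (.inr (some c.start)), (M.tm.initialState, x₀, none),
        joinStk (fun _ => []) (update (fun _ => []) inp w)⟩) =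
      some ⟨none, (M.tm.initialState, x₀, none),
        joinStk (update (fun _ => []) M.tm.k₁ (r.map M.outputAlphabet.invFun)) fun _ => []⟩ := by
    rw [iterStep_add, iterStep_add]
    refine (congrArg (fun C => iterStep _ n (iterStep _ _ C)) ho).trans ?_
    refine (congrArg (iterStep _ n) hp).trans ?_
    rw [List.reverse_reverse, List.append_nil]
    exact hl
  refine ⟨⟨⟨t + (w'.length + 1) + n, ?_⟩, by dsimp only; omega⟩⟩
  change _ = some (haltList _ _)
  rw [initList_eq, haltList_eq]
  rw [← update_joinStk_inr, ← update_joinStk_inl, joinStk_nil] at main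
  refine Eq.trans ?_ main
  refine congrArg (iterStep (thenCode c out M) _) (congrArg some ?_)
  refine congrArg (TM2.Cfg.mk _ _) (congrArg (update _ _) ?_)
  exact List.map_id w

/-- `c` leads from the store `s` to the store `s'` in at most `T` steps. -/
def Runs (c : StackProg K X) (s s' : Store K X) (T : ℕ) : Prop := ∃ t ≤ T, Exec c s s' t

/-- A reduction computed by a program in quadratic time carries time bounds over. -/
theorem solvableInOStar_of_runs [Fintype K] [Fintype X] {P Q : ParamProblem} {b b' : ℝ}
    (hb' : 1 ≤ b') (c : StackProg K X) {inp out : K} (hio : inp ≠ out) (x₀ : X) (T A : ℕ)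
    (hP : ∀ x, P.encode x ≠ [])
    (h : ∀ x, ∃ y, (P.yes x ↔ Q.yes y) ∧ b ^ Q.param y ≤ A * b' ^ P.param x ∧
      Runs c (single x₀ inp (P.encode x)) (single x₀ out (Q.encode y).reverse)
        (T * (P.encode x).length ^ 2))
    (hQ : Q.SolvableInOStar b) : P.SolvableInOStar b' := by
  obtain ⟨M, C, e, hM⟩ := hQ
  refine ⟨thenMachine c inp out x₀ M, 2 * T + 1 + C * A * T ^ e, 2 * e + 2, fun x => ?_⟩
  obtain ⟨y, hyes, hpar, t, ht, hrun⟩ := h x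
  obtain ⟨u, hu, hout⟩ := hM y
  refine ⟨t + ((Q.encode y).length + 1) + u, ?_, ?_⟩
  · set N := (P.encode x).length with hN
    have hN1 : 1 ≤ N := List.length_pos_iff.2 (hP x)
    -- the word that is written is no longer than the time it took
    have hw : (Q.encode y).length ≤ T * N ^ 2 := by
      have := hrun.length_le out
      simp only [single, update_self, List.length_reverse, update_of_ne hio.symm] at this
      simp only [List.length_nil, Nat.zero_add] at this
      omega
    have h1 : (1 : ℝ) ≤ (N : ℝ) := by exact_mod_cast hN1
    have hbn : (1 : ℝ) ≤ b' ^ P.param x := one_le_pow₀ hb'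
    have hw' : ((Q.encode y).length : ℝ) ≤ T * (N : ℝ) ^ 2 := by exact_mod_cast hw
    have ht' : (t : ℝ) ≤ T * (N : ℝ) ^ 2 := by exact_mod_cast ht
    have hu' : (u : ℝ) ≤ C * A * T ^ e * (b' ^ P.param x * (N : ℝ) ^ (2 * e + 2)) := by
      calc (u : ℝ) ≤ C * b ^ Q.param y * ((Q.encode y).length : ℝ) ^ e := hu
        _ ≤ C * (A * b' ^ P.param x) * (T * (N : ℝ) ^ 2) ^ e := by gcongr
        _ = C * A * T ^ e * (b' ^ P.param x * (N : ℝ) ^ (2 * e)) := by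
          rw [mul_pow, pow_mul]; ring
        _ ≤ _ := by gcongr; omega
    have h2 : (N : ℝ) ^ 2 ≤ b' ^ P.param x * (N : ℝ) ^ (2 * e + 2) := by
      have : (N : ℝ) ^ 2 ≤ (N : ℝ) ^ (2 * e + 2) := pow_le_pow_right₀ h1 (by omega)
      nlinarith [pow_nonneg (zero_le_one.trans h1) (2 * e + 2)]
    have h3 : (1 : ℝ) ≤ b' ^ P.param x * (N : ℝ) ^ (2 * e + 2) :=
      one_le_mul_of_one_le_of_one_le hbn (one_le_pow₀ h1)
    have h4 : (T : ℝ) * (N : ℝ) ^ 2 ≤ T * (b' ^ P.param x * (N : ℝ) ^ (2 * e + 2)) := by gcongr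
    push_cast
    nlinarith
  · rw [decide_eq_decide.2 hyes]
    exact thenMachine_outputs hrun hout

end StackProg

/-! ### Linear forests -/

/-- A graph whose vertices can be numbered so that adjacent vertices get consecutive numbers is a
linear forest. -/
theorem isLinearForest_of_consecutive {V : Type} (G : SimpleGraph V) (f : V → ℕ)
    (hf : Function.Injective f) (h : ∀ u v, G.Adj u v → f v = f u + 1 ∨ f u = f v + 1) :
    IsLinearForest V G := by
  constructor
  · rw [SimpleGraph.isAcyclic_iff_forall_adj_isBridge]
    -- without the edge `v w`, no walk leaves the set of vertices numbered at most `f v`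
    have key : ∀ v w, G.Adj v w → f w = f v + 1 → G.IsBridge s(v, w) := by
      intro v w hvw e
      rw [SimpleGraph.isBridge_iff]
      rintro ⟨p⟩
      have : ∀ x y, (G.deleteEdges {s(v, w)}).Walk x y → f x ≤ f v → f y ≤ f v := by
        intro x y p
        induction p with
        | nil => exact id
        | @cons x y z hxy _ ih =>
          intro hx
          apply ih
          rw [SimpleGraph.deleteEdges_adj] at hxy
          obtain ⟨hxy, hne⟩ := hxy
          by_contra hy
          have hy' : f y = f x + 1 ∧ f x = f v := by
            rcases h _ _ hxy with h | h <;> omega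
          have e₁ : x = v := hf hy'.2
          have e₂ : y = w := hf (by omega)
          subst e₁ e₂
          exact hne rfl
      have := this v w p le_rfl
      omega
    intro v w hvw
    rcases h _ _ hvw with e | e
    · exact key v w hvw e
    · rw [Sym2.eq_swap]
      exact key w v hvw.symm e
  · intro v
    rw [← hf.encard_image]
    refine (Set.encard_le_encard (t := {f v + 1, f v - 1}) ?_).trans 
      ((Set.encard_insert_le _ _).trans (by rw [Set.encard_singleton]; rfl))
    rintro _ ⟨u, hu, rfl⟩
    rcases h _ _ hu with e | e
    · exact Or.inl e
    · right
      rw [e]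
      rfl

/-! ### Coloring instances from lists of edges -/

/-- The word of an edge. -/
def edgeWord (e : ℕ × ℕ) : List Bool := unaryWord e.1 ++ unaryWord e.2

/-- The instance with vertices `0, …, n - 1`, the given edges and the modulator
`{0, …, base - 1}`. -/
def listInstance (n base : ℕ) (L : List (ℕ × ℕ)) (hlt : ∀ e ∈ L, e.1 < n ∧ e.2 < n)
    (hne : ∀ e ∈ L, e.1 ≠ e.2)
    (hpath : ∀ e ∈ L, base ≤ e.1 → base ≤ e.2 → e.2 = e.1 + 1) : KvInstance IsLinearForest where
  n := n
  G :=
    { Adj := fun u v => ((u : ℕ), (v : ℕ)) ∈ L ∨ ((v : ℕ), (u : ℕ)) ∈ L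
      symm := ⟨fun _ _ => Or.symm⟩
      loopless := ⟨fun u h => hne _ (or_self_iff.1 h) rfl⟩ }
  edges := L.pmap (fun e he => (⟨e.1, he.1⟩, ⟨e.2, he.2⟩)) hlt
  adj_iff u v := by
    have (a b : Fin n) : (a, b) ∈ L.pmap (fun e he => ((⟨e.1, he.1⟩ : Fin n),
        (⟨e.2, he.2⟩ : Fin n))) hlt ↔ ((a : ℕ), (b : ℕ)) ∈ L := by
      rw [List.mem_pmap]
      constructor
      · rintro ⟨e, he, h⟩
        obtain ⟨rfl, rfl⟩ := Prod.mk.inj h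
        exact he
      · intro h
        exact ⟨_, h, rfl⟩
    rw [this, this]
  X := Finset.univ.filter fun v => v.val < base
  modulator := by
    refine isLinearForest_of_consecutive _ (fun v => v.1.val)
      (fun u v h => Subtype.ext (Fin.ext h)) ?_
    rintro ⟨u, hu⟩ ⟨v, hv⟩ h
    simp only [Set.mem_ofPred_eq, Finset.mem_filter, Finset.mem_univ, true_and, not_lt] at hu hv
    rcases h with h | h
    · exact Or.inl (hpath _ h hu hv)
    · exact Or.inr (hpath _ h hv hu)

section ListInstance

variable {n base : ℕ} {L : List (ℕ × ℕ)} {hlt : ∀ e ∈ L, e.1 < n ∧ e.2 < n}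
  {hne : ∀ e ∈ L, e.1 ≠ e.2} {hpath : ∀ e ∈ L, base ≤ e.1 → base ≤ e.2 → e.2 = e.1 + 1}

theorem ofFn_decide_lt (base n : ℕ) (h : base ≤ n) :
    (List.ofFn fun v : Fin n => decide (v.val < base)) =
      List.replicate base true ++ List.replicate (n - base) false := by
  apply List.ext_getElem
  · simp; omega
  · intro i h₁ h₂
    rw [List.getElem_ofFn, List.getElem_append]
    split_ifs with hi
    · simpa using hi
    · simpa using hi

theorem listWord_pmap (n : ℕ) (L : List (ℕ × ℕ)) (hlt : ∀ e ∈ L, e.1 < n ∧ e.2 < n) :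
    listWord (fun e : Fin n × Fin n => unaryWord e.1 ++ unaryWord e.2)
      (L.pmap (fun e he => (⟨e.1, he.1⟩, ⟨e.2, he.2⟩)) hlt) = listWord edgeWord L := by
  rw [listWord, listWord, List.flatMap_def, List.map_pmap, List.flatMap_def]
  exact congrArg (fun l => l.flatten ++ [false])
    (List.pmap_eq_map (f := fun a => true :: edgeWord a) hlt)

theorem listInstance_encode (h : base ≤ n) :
    (listInstance n base L hlt hne hpath).encode =
      unaryWord n ++ listWord edgeWord L ++
        (List.replicate base true ++ List.replicate (n - base) false) := by
  rw [KvInstance.encode, ← ofFn_decide_lt base n h]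
  congr 1
  · congr 1
    exact listWord_pmap n L hlt
  · change (List.ofFn fun v : Fin n => _) = _
    congr 1
    funext v
    refine decide_eq_decide.2 ?_
    change v ∈ Finset.univ.filter (fun v : Fin n => v.val < base) ↔ _
    simp

theorem listInstance_card (h : base ≤ n) : (listInstance n base L hlt hne hpath).X.card = base := by
  change (Finset.univ.filter fun v : Fin n => v.val < base).card = base
  rw [Fin.card_filter_val_lt, min_eq_right h]

theorem listInstance_colorable (q : ℕ) : (listInstance n base L hlt hne hpath).G.Colorable q ↔
    ∃ col : ℕ → ℕ, (∀ v < n, col v < q) ∧ ∀ e ∈ L, col e.1 ≠ col e.2 := by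
  constructor
  · rintro ⟨C⟩
    refine ⟨fun v => if h : v < n then (C ⟨v, h⟩).val else 0, fun v hv => ?_, fun e he => ?_⟩
    · simp only [hv, dif_pos]
      exact (C ⟨v, hv⟩).isLt
    · have h := hlt e he
      simp only [h.1, h.2, dif_pos]
      intro heq
      exact C.valid (v := (⟨e.1, h.1⟩ : Fin n)) (w := (⟨e.2, h.2⟩ : Fin n)) (Or.inl he)
        (Fin.ext heq)
  · rintro ⟨col, hq, hL⟩
    refine ⟨SimpleGraph.Coloring.mk (fun v => ⟨col v.val, hq _ v.isLt⟩) ?_⟩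
    rintro u v (h | h) heq
    · exact hL _ h (Fin.mk.inj_iff.1 heq)
    · exact hL _ h (Fin.mk.inj_iff.1 heq).symm

end ListInstance

/-! ### Path gadgets -/

/-- A vertex of a path gadget, to be coloured with a colour from the list `allowed`. If
`att = some (g, i)`, the vertex is adjacent to the `i`-th vertex of the group `g` of the modulator;
if `link` holds, it is adjacent to the next vertex. -/
structure PathVertex (ι : Type) where
  /-- the list of allowed colours -/
  allowed : List ℕ
  /-- the neighbour in the modulator -/
  att : Option (ι × ℕ)
  /-- whether the vertex is joined to the next one -/
  link : Bool

namespace PathVertex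

variable {ι κ : Type}

/-- Rename the groups. -/
def map (f : ι → κ) (v : PathVertex ι) : PathVertex κ :=
  ⟨v.allowed, v.att.map (Prod.map f id), v.link⟩

/-- `Extends h p V`: the consecutive path vertices `V` can be coloured, where `h g i` is the colour
of the `i`-th vertex of the group `g`, and `p` is the colour of the vertex before `V`, if `V` is
joined to it. -/
def Extends (h : ι → ℕ → ℕ) : Option ℕ → List (PathVertex ι) → Prop
  | p, [] => p = none
  | p, v :: V => ∃ c ∈ v.allowed, p ≠ some c ∧ (∀ a ∈ v.att, h a.1 a.2 ≠ c) ∧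
      Extends h (if v.link then some c else none) V

/-- A path segment that transmits a state, which is the colour, `0` or `1`, of the last vertex
before the segment and of the last vertex of the segment. State `1` can always be kept;
state `0` can be turned into `1` if and only if the attached vertex does not have colour `c`.

If `c` is neither `0` nor `1`, then one attached vertex with the colours `0, 1, c` suffices: after
state `0` it can only get the colour `1` or, if the attached vertex allows it, the colour `c`, and
only the latter permits state `1`. If `c` is `0` or `1`, the state is represented around the attached
vertex by two colours one of which differs from `0` and `1`. -/
def block : ι × ℕ × ℕ → List (PathVertex ι)
  | (g, i, 0) => [⟨[0, 1], none, true⟩, ⟨[1, 2], none, true⟩, ⟨[0, 1, 2], some (g, i), true⟩,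
      ⟨[0, 1], none, true⟩]
  | (g, i, 1) => [⟨[0, 2], none, true⟩, ⟨[0, 1, 2], some (g, i), true⟩, ⟨[0, 1], none, true⟩,
      ⟨[0, 1], none, true⟩]
  | (g, i, c + 2) => [⟨[0, 1, c + 2], some (g, i), true⟩, ⟨[0, 1], none, true⟩]

/-- A path that can be coloured if and only if the colouring of the modulator avoids the given
partial colouring `cs` somewhere: the state is `0` at its start and has to be `1` at its end. -/
def path (cs : List (ι × ℕ × ℕ)) : List (PathVertex ι) :=
  ⟨[0], none, true⟩ :: (cs.flatMap block ++ [⟨[0], none, false⟩])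

section Extends

variable (h : ι → ℕ → ℕ) (V : List (PathVertex ι))

theorem extends_block_of_one (l : ι × ℕ × ℕ) (hV : Extends h (some 1) V) :
    Extends h (some 1) (block l ++ V) := by
  obtain ⟨g, i, _ | _ | c⟩ := l
  · by_cases hx : h g i = 2 <;> simp [block, Extends, hx, hV]
  · by_cases hx : h g i = 2 <;> simp [block, Extends, hx, hV]
  · by_cases hx : h g i = 0 <;> simp [block, Extends, hx, hV]

theorem extends_block_of_ne (l : ι × ℕ × ℕ) (hl : h l.1 l.2.1 ≠ l.2.2)
    (hV : Extends h (some 1) V) : Extends h (some 0) (block l ++ V) := by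
  obtain ⟨g, i, _ | _ | c⟩ := l <;> simp_all [block, Extends]

theorem extends_block_iff_of_eq (l : ι × ℕ × ℕ) (hl : h l.1 l.2.1 = l.2.2) :
    Extends h (some 0) (block l ++ V) ↔ Extends h (some 0) V := by
  obtain ⟨g, i, _ | _ | c⟩ := l <;> simp_all [block, Extends]

/-- The state `1` can be reached from `0` as soon as one of the blocks admits the change. -/
theorem extends_blocks_iff (cs : List (ι × ℕ × ℕ)) (hV₀ : ¬ Extends h (some 0) V)
    (hV₁ : Extends h (some 1) V) :
    Extends h (some 1) (cs.flatMap block ++ V) ∧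
      (Extends h (some 0) (cs.flatMap block ++ V) ↔ ∃ l ∈ cs, h l.1 l.2.1 ≠ l.2.2) := by
  induction cs with
  | nil => simp [hV₀, hV₁]
  | cons l cs ih =>
    rw [List.flatMap_cons, List.append_assoc]
    refine ⟨extends_block_of_one _ _ _ ih.1, ?_⟩
    rw [List.exists_mem_cons_iff, ← ih.2]
    by_cases hl : h l.1 l.2.1 = l.2.2
    · simp only [hl, ne_eq, not_true_eq_false, false_or]
      exact extends_block_iff_of_eq _ _ _ hl
    · exact ⟨fun _ => Or.inl hl, fun _ => extends_block_of_ne _ _ _ hl ih.1⟩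

theorem extends_path_iff (cs : List (ι × ℕ × ℕ)) :
    Extends h none (path cs ++ V) ↔ (∃ l ∈ cs, h l.1 l.2.1 ≠ l.2.2) ∧ Extends h none V := by
  have e : Extends h none (path cs ++ V) ↔
      Extends h (some 0) (cs.flatMap block ++ (⟨[0], none, false⟩ :: V)) := by
    simp [path, Extends]
  rw [e]
  by_cases hV : Extends h none V
  · rw [(extends_blocks_iff h _ cs (by simp [Extends]) (by simp [Extends, hV])).2]
    simp [hV]
  · simp only [hV, and_false, iff_false]
    -- neither state can be continued past the segment
    have key : ∀ (W : List (PathVertex ι)) (p : Option ℕ),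
        ¬ Extends h p (W ++ (⟨[0], none, false⟩ :: V)) := by
      intro W
      induction W with
      | nil => intro p hp; simp [Extends, hV] at hp
      | cons w W ih =>
        rintro p ⟨c, -, -, -, hc⟩
        exact ih _ hc
    exact key _ _

end Extends

section Gadget

variable {q p t : ℕ} (D : (Fin t → Fin q) → Fin p → Bool)

/-- The partial colourings of the modulator under which all literals of a clause are false. A
literal is given by its group `g`, its position `x` in the group and its sign `b`; a group whose `t`
vertices have the colours `f` stands for the assignment `D f`. -/
noncomputable def conflicts : List (ι × Fin p × Bool) → List (List (ι × ℕ × ℕ))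
  | [] => [[]]
  | (g, x, b) :: τ => (Finset.univ.filter fun f => D f x ≠ b).toList.flatMap fun f =>
      (conflicts τ).map fun cs => (List.ofFn fun i : Fin t => (g, i.val, (f i).val)) ++ cs

/-- The paths that enforce a clause. -/
noncomputable def gadget (τ : List (ι × Fin p × Bool)) : List (PathVertex ι) :=
  (conflicts D τ).flatMap path

theorem exists_conflict_iff (h : ι → ℕ → ℕ) (f : ι → Fin t → Fin q) (τ : List (ι × Fin p × Bool))
    (hf : ∀ l ∈ τ, ∀ i : Fin t, h l.1 i = f l.1 i) :
    (∃ cs ∈ conflicts D τ, ∀ l ∈ cs, h l.1 l.2.1 = l.2.2) ↔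
      ∀ l ∈ τ, D (f l.1) l.2.1 ≠ l.2.2 := by
  induction τ with
  | nil => simp [conflicts]
  | cons l τ ih =>
    obtain ⟨g, x, b⟩ := l
    have ih := ih fun l hl => hf l (List.mem_cons_of_mem _ hl)
    have hg := hf _ List.mem_cons_self
    simp only at hg
    rw [List.forall_mem_cons, ← ih]
    constructor
    · rintro ⟨cs, hcs, h⟩
      simp only [conflicts, List.mem_flatMap, Finset.mem_toList, Finset.mem_filter,
        Finset.mem_univ, true_and, List.mem_map] at hcs
      obtain ⟨f', hf', cs, hcs, rfl⟩ := hcs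
      rw [List.forall_mem_append] at h
      refine ⟨?_, cs, hcs, h.2⟩
      have : f g = f' := by
        funext i
        have := h.1 (g, i.val, (f' i).val) ((List.mem_ofFn' _ _).2 ⟨i, rfl⟩)
        simp only [hg] at this
        exact Fin.ext this
      rw [this]
      exact hf'
    · rintro ⟨hD, cs, hcs, h⟩
      refine ⟨(List.ofFn fun i : Fin t => (g, i.val, (f g i).val)) ++ cs, ?_, ?_⟩
      · simp only [conflicts, List.mem_flatMap, Finset.mem_toList, Finset.mem_filter,
          Finset.mem_univ, true_and, List.mem_map]
        exact ⟨f g, hD, cs, hcs, rfl⟩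
      · rw [List.forall_mem_append]
        refine ⟨?_, h⟩
        intro l hl
        obtain ⟨i, rfl⟩ := (List.mem_ofFn' _ _).1 hl
        exact hg i

theorem extends_flatMap_path_iff (h : ι → ℕ → ℕ) (css : List (List (ι × ℕ × ℕ)))
    (V : List (PathVertex ι)) : Extends h none (css.flatMap path ++ V) ↔
      (∀ cs ∈ css, ∃ l ∈ cs, h l.1 l.2.1 ≠ l.2.2) ∧ Extends h none V := by
  induction css with
  | nil => simp
  | cons cs css ih =>
    rw [List.flatMap_cons, List.append_assoc, extends_path_iff, ih, List.forall_mem_cons, and_assoc]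

/-- The paths of a clause can be coloured if and only if the colouring of the modulator satisfies
the clause. -/
theorem extends_gadget_iff (h : ι → ℕ → ℕ) (f : ι → Fin t → Fin q) (τ : List (ι × Fin p × Bool))
    (hf : ∀ l ∈ τ, ∀ i : Fin t, h l.1 i = f l.1 i) (V : List (PathVertex ι)) :
    Extends h none (gadget D τ ++ V) ↔
      (∃ l ∈ τ, D (f l.1) l.2.1 = l.2.2) ∧ Extends h none V := by
  rw [gadget, extends_flatMap_path_iff]
  refine and_congr_left fun _ => ?_
  have := not_congr (exists_conflict_iff D h f τ hf)
  push Not at this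
  simpa using this

theorem extends_gadgets_iff (h : ι → ℕ → ℕ) (f : ι → Fin t → Fin q)
    (τs : List (List (ι × Fin p × Bool)))
    (hf : ∀ τ ∈ τs, ∀ l ∈ τ, ∀ i : Fin t, h l.1 i = f l.1 i) :
    Extends h none (τs.flatMap (gadget D)) ↔ ∀ τ ∈ τs, ∃ l ∈ τ, D (f l.1) l.2.1 = l.2.2 := by
  induction τs with
  | nil => simp [Extends]
  | cons τ τs ih =>
    rw [List.flatMap_cons, extends_gadget_iff D h f τ (hf τ List.mem_cons_self),
      ih fun τ hτ => hf τ (List.mem_cons_of_mem _ hτ), List.forall_mem_cons]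

theorem map_conflicts (r : ι → κ) (τ : List (ι × Fin p × Bool)) :
    conflicts D (τ.map (Prod.map r id)) = (conflicts D τ).map (List.map (Prod.map r id)) := by
  induction τ with
  | nil => rfl
  | cons l τ ih =>
    obtain ⟨g, x, b⟩ := l
    simp [conflicts, ih, List.map_flatMap, List.map_ofFn, Function.comp_def]

theorem map_block (r : ι → κ) (l : ι × ℕ × ℕ) :
    block (Prod.map r id l) = (block l).map (PathVertex.map r) := by
  obtain ⟨g, i, _ | _ | c⟩ := l <;> simp [block, PathVertex.map]

theorem map_path (r : ι → κ) (cs : List (ι × ℕ × ℕ)) :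
    path (cs.map (Prod.map r id)) = (path cs).map (PathVertex.map r) := by
  simp [path, PathVertex.map, List.map_flatMap, List.flatMap_map, map_block]

/-- The gadget is built in the same way whatever the groups are called. -/
theorem map_gadget (r : ι → κ) (τ : List (ι × Fin p × Bool)) :
    gadget D (τ.map (Prod.map r id)) = (gadget D τ).map (PathVertex.map r) := by
  simp [gadget, map_conflicts, List.map_flatMap, List.flatMap_map, map_path]

theorem mem_of_mem_conflicts {τ : List (ι × Fin p × Bool)} {cs : List (ι × ℕ × ℕ)}
    (hcs : cs ∈ conflicts D τ) {l : ι × ℕ × ℕ} (hl : l ∈ cs) :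
    (∃ l' ∈ τ, l'.1 = l.1) ∧ l.2.1 < t ∧ l.2.2 < q := by
  induction τ generalizing cs with
  | nil =>
    simp only [conflicts, List.mem_singleton] at hcs
    simp [hcs] at hl
  | cons l' τ ih =>
    obtain ⟨g, x, b⟩ := l'
    simp only [conflicts, List.mem_flatMap, Finset.mem_toList, Finset.mem_filter,
      Finset.mem_univ, true_and, List.mem_map] at hcs
    obtain ⟨f, -, cs, hcs, rfl⟩ := hcs
    rcases List.mem_append.1 hl with hl | hl
    · obtain ⟨i, rfl⟩ := (List.mem_ofFn' _ _).1 hl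
      exact ⟨⟨_, List.mem_cons_self, rfl⟩, i.isLt, (f i).isLt⟩
    · obtain ⟨⟨l', hl', e⟩, h⟩ := ih hcs hl
      exact ⟨⟨l', List.mem_cons_of_mem _ hl', e⟩, h⟩

theorem mem_block {l : ι × ℕ × ℕ} (hq : 3 ≤ q) (hl : l.2.2 < q) {v : PathVertex ι}
    (hv : v ∈ block l) :
    (∀ c ∈ v.allowed, c < q) ∧ ∀ a ∈ v.att, a = (l.1, l.2.1) := by
  obtain ⟨g, i, _ | _ | c⟩ := l <;> simp only [block, List.mem_cons, List.not_mem_nil, or_false]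
    at hv <;> rcases hv with rfl | rfl | rfl | rfl <;> simp at hl ⊢ <;> omega

theorem mem_gadget (hq : 3 ≤ q) {τ : List (ι × Fin p × Bool)} {v : PathVertex ι}
    (hv : v ∈ gadget D τ) :
    (∀ c ∈ v.allowed, c < q) ∧ ∀ a ∈ v.att, (∃ l ∈ τ, l.1 = a.1) ∧ a.2 < t := by
  simp only [gadget, List.mem_flatMap, path, List.mem_cons, List.mem_append, List.not_mem_nil,
    or_false] at hv
  obtain ⟨cs, hcs, rfl | ⟨l, hl, hv⟩ | rfl⟩ := hv
  · simp; omega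
  · obtain ⟨h₁, h₂, h₃⟩ := mem_of_mem_conflicts D hcs hl
    obtain ⟨h₄, h₅⟩ := mem_block hq h₃ hv
    refine ⟨h₄, fun a ha => ?_⟩
    rw [h₅ a ha]
    exact ⟨h₁, h₂⟩
  · simp; omega

/-- The last vertex is not joined to anything that follows. -/
def Closed (V : List (PathVertex ι)) : Prop := ∀ v ∈ V.getLast?, v.link = false

theorem Closed.append {V W : List (PathVertex ι)} (hV : Closed V) (hW : Closed W) :
    Closed (V ++ W) := by
  intro v hv
  rw [List.getLast?_append] at hv
  rcases hw : W.getLast? with _ | w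
  · rw [hw] at hv; exact hV v hv
  · rw [hw] at hv
    exact hW v (by rw [hw]; exact hv)

theorem closed_flatMap {α : Type} (L : List α) (F : α → List (PathVertex ι))
    (hF : ∀ a, Closed (F a)) : Closed (L.flatMap F) := by
  induction L with
  | nil => simp [Closed]
  | cons a L ih => rw [List.flatMap_cons]; exact (hF a).append ih

theorem closed_gadget (τ : List (ι × Fin p × Bool)) : Closed (gadget D τ) :=
  closed_flatMap _ _ fun cs => by
    intro v hv
    rw [path, ← List.cons_append, List.getLast?_append] at hv
    simp at hv
    simp [← hv]

end Gadget

end PathVertex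

/-! ### The coloring instance of a formula -/

/-- A vertex, given relative to the path vertex that is being written: a fixed vertex, a path vertex
at a given distance, or the vertex with a given offset in a group of the modulator. -/
inductive Addr (ι : Type) where
  /-- the vertex `n` -/
  | const (n : ℕ)
  /-- the path vertex `n` places after the present one -/
  | next (n : ℕ)
  /-- the vertex `n` places after the position of the group `g` -/
  | lit (g : ι) (n : ℕ)

namespace Addr

variable {ι : Type}

/-- The number of a vertex, where `c` is the number of the present path vertex and `r` gives the
positions of the groups. -/
def eval (r : ι → ℕ) (c : ℕ) : Addr ι → ℕ
  | const n => n
  | next n => c + n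
  | lit g n => r g + n

end Addr

namespace PathVertex

variable {ι κ : Type}

/-- The edges to be written for a path vertex. The vertices `0, …, q - 1` are a palette: they stand
for the colours, and a path vertex is joined to the colours it must not have. -/
def edges (q : ℕ) (v : PathVertex ι) : List (Addr ι × Addr ι) :=
  ((List.range q).filter fun d => d ∉ v.allowed).map (fun d => (.next 0, .const d)) ++
    (v.att.toList.map fun a => (.next 0, .lit a.1 (q + a.2))) ++
    if v.link then [(.next 0, .next 1)] else []

/-- The edges of consecutive path vertices, the first of which is the vertex `c`. -/
def pathEdges (q : ℕ) (r : ι → ℕ) : ℕ → List (PathVertex ι) → List (ℕ × ℕ)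
  | _, [] => []
  | c, v :: V => pathEdges q r (c + 1) V ++
      (v.edges q).map (Prod.map (Addr.eval r c) (Addr.eval r c))

theorem pathEdges_map (q : ℕ) (f : ι → κ) (r : κ → ℕ) (c : ℕ) (V : List (PathVertex ι)) :
    pathEdges q r c (V.map (PathVertex.map f)) = pathEdges q (r ∘ f) c V := by
  induction V generalizing c with
  | nil => rfl
  | cons v V ih =>
    rw [List.map_cons, pathEdges, pathEdges, ih]
    congr 1
    obtain ⟨A, _ | a, _ | _⟩ := v <;>
      simp only [edges, PathVertex.map, List.map_append, List.map_map] <;> rfl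

theorem pathEdges_append (q : ℕ) (r : ι → ℕ) (c : ℕ) (V W : List (PathVertex ι)) :
    pathEdges q r c (V ++ W) = pathEdges q r (c + V.length) W ++ pathEdges q r c V := by
  induction V generalizing c with
  | nil => simp [pathEdges]
  | cons v V ih =>
    rw [List.cons_append, pathEdges, pathEdges, ih, List.append_assoc, List.length_cons]
    congr 2
    omega

theorem mem_edges_eval {q : ℕ} {c : ℕ} {v : PathVertex ℕ} {e : ℕ × ℕ} :
    e ∈ (v.edges q).map (Prod.map (Addr.eval id c) (Addr.eval id c)) ↔
      e.1 = c ∧ ((e.2 < q ∧ e.2 ∉ v.allowed) ∨ (∃ a ∈ v.att, e.2 = a.1 + (q + a.2)) ∨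
        (v.link = true ∧ e.2 = c + 1)) := by
  obtain ⟨x, y⟩ := e
  obtain ⟨A, a, l⟩ := v
  simp only [edges, List.mem_map, List.mem_append, List.mem_filter, List.mem_range,
    decide_eq_true_eq, Option.mem_toList]
  constructor
  · rintro ⟨e, (⟨d, hd, rfl⟩ | ⟨a, ha, rfl⟩) | he, h⟩
    · obtain ⟨rfl, rfl⟩ := Prod.mk.inj h
      exact ⟨rfl, Or.inl hd⟩
    · obtain ⟨rfl, rfl⟩ := Prod.mk.inj h
      exact ⟨rfl, Or.inr (Or.inl ⟨a, ha, rfl⟩)⟩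
    · cases l
      · simp at he
      · simp only [if_true, List.mem_singleton] at he
        subst he
        obtain ⟨rfl, rfl⟩ := Prod.mk.inj h
        exact ⟨rfl, Or.inr (Or.inr ⟨rfl, rfl⟩)⟩
  · rintro ⟨rfl, h⟩
    rcases h with h | ⟨a, ha, rfl⟩ | ⟨rfl, rfl⟩
    · exact ⟨_, Or.inl (Or.inl ⟨y, h, rfl⟩), rfl⟩
    · exact ⟨_, Or.inl (Or.inr ⟨a, ha, rfl⟩), rfl⟩
    · exact ⟨(.next 0, .next 1), Or.inr (by simp), rfl⟩

theorem mem_pathEdges_bounds {q base : ℕ} (hq : q ≤ base) {V : List (PathVertex ℕ)}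
    (hV : Closed V) (hatt : ∀ v ∈ V, ∀ a ∈ v.att, a.1 + (q + a.2) < base) {c : ℕ}
    {e : ℕ × ℕ} (he : e ∈ pathEdges q id c V) :
    c ≤ e.1 ∧ e.1 < c + V.length ∧ (e.2 < base ∨ e.2 = e.1 + 1 ∧ e.2 < c + V.length) := by
  induction V generalizing c with
  | nil => simp [pathEdges] at he
  | cons v V ih =>
    rw [pathEdges, List.mem_append, mem_edges_eval] at he
    rw [List.length_cons]
    rcases he with he | ⟨rfl, he⟩
    · have hV' : Closed V := by
        rcases V with _ | ⟨w, V⟩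
        · simp [Closed]
        · simpa [Closed, List.getLast?_cons_cons] using hV
      have := ih hV' (fun w hw => hatt w (List.mem_cons_of_mem _ hw)) he
      omega
    · refine ⟨le_rfl, by omega, ?_⟩
      rcases he with ⟨h, -⟩ | ⟨a, ha, h⟩ | ⟨hl, h⟩
      · omega
      · have := hatt v List.mem_cons_self a ha
        omega
      · refine Or.inr ⟨h, ?_⟩
        rcases V with _ | ⟨w, V⟩
        · have := hV v (by simp)
          simp [hl] at this
        · simp [h]

/-- A proper colouring that gives each palette vertex its own colour colours the paths as
required. -/
theorem extends_of_coloring {q : ℕ} (col : ℕ → ℕ) (hpal : ∀ d < q, col d = d)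
    (V : List (PathVertex ℕ)) (c : ℕ) (p : Option ℕ)
    (hcol : ∀ v, c ≤ v → v < c + V.length → col v < q)
    (hE : ∀ e ∈ pathEdges q id c V, e.2 ≤ e.1 ∨ e.2 < c + V.length)
    (hedge : ∀ e ∈ pathEdges q id c V, col e.1 ≠ col e.2)
    (hp : p = none ∨ V ≠ [] ∧ p ≠ some (col c)) :
    Extends (fun g i => col (g + (q + i))) p V := by
  induction V generalizing c p with
  | nil => simpa [Extends] using hp
  | cons v V ih =>
    simp only [pathEdges, List.mem_append, mem_edges_eval, List.length_cons] at hE hedge hcol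
    have hc := hcol c le_rfl (by omega)
    refine ⟨col c, ?_, ?_, fun a ha => ?_, ih (c + 1) _ (fun w h₁ h₂ => hcol w (by omega)
      (by omega)) (fun e he => ?_) (fun e he => hedge e (Or.inl he)) ?_⟩
    · by_contra hn
      exact hedge (c, col c) (Or.inr ⟨rfl, Or.inl ⟨hc, hn⟩⟩) (hpal _ hc).symm
    · rcases hp with rfl | hp
      · simp
      · exact hp.2
    · exact (hedge (c, a.1 + (q + a.2)) (Or.inr ⟨rfl, Or.inr (Or.inl ⟨a, ha, rfl⟩)⟩)).symm
    · have := hE e (Or.inl he)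
      omega
    · rcases hl : v.link with _ | _
      · simp
      · right
        refine ⟨?_, ?_⟩
        · rintro rfl
          have := hE (c, c + 1) (Or.inr ⟨rfl, Or.inr (Or.inr ⟨hl, rfl⟩)⟩)
          simp at this
        · have := hedge (c, c + 1) (Or.inr ⟨rfl, Or.inr (Or.inr ⟨hl, rfl⟩)⟩)
          simpa using this

/-- Conversely, colourings of the modulator and of the paths fit together. -/
theorem exists_coloring_of_extends {q base : ℕ} (hq : q ≤ base) (V : List (PathVertex ℕ))
    (hatt : ∀ v ∈ V, ∀ a ∈ v.att, a.1 + (q + a.2) < base)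
    (hall : ∀ v ∈ V, ∀ d ∈ v.allowed, d < q) (h : ℕ → ℕ → ℕ) (c : ℕ) (hc : base ≤ c)
    (col : ℕ → ℕ) (hpal : ∀ d < q, col d = d)
    (hh : ∀ g i, g + (q + i) < base → h g i = col (g + (q + i)))
    (p : Option ℕ) (hV : Extends h p V) :
    ∃ col' : ℕ → ℕ, (∀ v < c, col' v = col v) ∧ (∀ v, c ≤ v → v < c + V.length → col' v < q) ∧
      (∀ e ∈ pathEdges q id c V, col' e.1 ≠ col' e.2) ∧ (p = none ∨ p ≠ some (col' c)) := by
  induction V generalizing c col p with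
  | nil =>
    refine ⟨col, fun _ _ => rfl, fun v h₁ h₂ => ?_, by simp [pathEdges], Or.inl hV⟩
    simp at h₂
    omega
  | cons v V ih =>
    obtain ⟨d, hd, hpd, ha, hV⟩ := hV
    have hatt' := hatt v List.mem_cons_self
    have hdq := hall v List.mem_cons_self d hd
    obtain ⟨col', h₁, h₂, h₃, h₄⟩ := ih (fun w hw => hatt w (List.mem_cons_of_mem _ hw))
      (fun w hw => hall w (List.mem_cons_of_mem _ hw)) (c + 1) (by omega)
      (Function.update col c d)
      (fun x hx => by rw [Function.update_of_ne (by omega), hpal x hx])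
      (fun g i hgi => by rw [Function.update_of_ne (by omega), hh g i hgi]) _ hV
    have hlt : ∀ x < c, col' x = col x := fun x hx => by
      rw [h₁ x (by omega), Function.update_of_ne (by omega)]
    have hcd : col' c = d := by rw [h₁ c (by omega), Function.update_self]
    refine ⟨col', hlt, fun x hx₁ hx₂ => ?_, fun e he => ?_, Or.inr (hcd ▸ hpd)⟩
    · rcases hx₁.eq_or_lt with rfl | hx
      · omega
      · exact h₂ x hx (by rw [List.length_cons] at hx₂; omega)
    · rw [pathEdges, List.mem_append, mem_edges_eval] at he
      obtain he | ⟨rfl, he⟩ := he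
      · exact h₃ e he
      rw [hcd]
      rcases he with ⟨hlt', hn⟩ | ⟨a, hav, h⟩ | ⟨hl, h⟩
      · rw [hlt _ (by omega), hpal _ hlt']
        exact fun h => hn (h ▸ hd)
      · rw [h, hlt _ ((hatt' a hav).trans_le hc), ← hh _ _ (hatt' a hav)]
        exact (ha a hav).symm
      · rw [h]
        simpa [hl] using h₄

end PathVertex

/-- The edges between the palette vertices. -/
def paletteEdges (q : ℕ) : List (ℕ × ℕ) :=
  (List.range q).flatMap fun d => (List.range d).map fun c => (c, d)

theorem mem_paletteEdges {q : ℕ} {e : ℕ × ℕ} : e ∈ paletteEdges q ↔ e.1 < e.2 ∧ e.2 < q := by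
  obtain ⟨x, y⟩ := e
  simp only [paletteEdges, List.mem_flatMap, List.mem_map, List.mem_range, Prod.mk.injEq]
  constructor
  · rintro ⟨d, hd, c, hc, rfl, rfl⟩
    exact ⟨hc, hd⟩
  · rintro ⟨h₁, h₂⟩
    exact ⟨y, h₂, x, h₁, rfl, rfl⟩

namespace BoundedCNF

open PathVertex

variable {s q p t : ℕ} [NeZero p]

/-- The literals of a clause, with variables given by their group, that is, by the position of the
group in the modulator, and their position in the group. The variable `i` belongs to the group
`i / p`, and each group has `t` vertices. -/
def groupLits (p t : ℕ) [NeZero p] {n : ℕ} (C : List (Fin n × Bool)) : List (ℕ × Fin p × Bool) :=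
  C.map fun l => (t * (l.1 / p), Fin.ofNat p l.1, l.2)

/-- The path vertices for a formula. -/
noncomputable def pathVertices (D : (Fin t → Fin q) → Fin p → Bool) (φ : BoundedCNF s) :
    List (PathVertex ℕ) :=
  (φ.clauses.map (groupLits p t)).flatMap (gadget D)

/-- The size of the modulator: the palette and the groups. -/
def modSize (q p t n : ℕ) : ℕ := q + t * (n / p + 1)

/-- The edges of the instance for a formula. -/
noncomputable def kvEdges (D : (Fin t → Fin q) → Fin p → Bool) (φ : BoundedCNF s) : List (ℕ × ℕ) :=
  pathEdges q id (modSize q p t φ.n) (φ.pathVertices D) ++ paletteEdges q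

section Instance

variable (D : (Fin t → Fin q) → Fin p → Bool) (φ : BoundedCNF s)

theorem closed_pathVertices : Closed (φ.pathVertices D) :=
  closed_flatMap _ _ (closed_gadget D)

theorem mem_pathVertices (hq : 3 ≤ q) {v : PathVertex ℕ} (hv : v ∈ φ.pathVertices D) :
    (∀ d ∈ v.allowed, d < q) ∧ ∀ a ∈ v.att, a.1 + (q + a.2) < modSize q p t φ.n := by
  simp only [pathVertices, List.mem_flatMap, List.mem_map] at hv
  obtain ⟨_, ⟨C, hC, rfl⟩, hv⟩ := hv
  obtain ⟨h₁, h₂⟩ := mem_gadget D hq hv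
  refine ⟨h₁, fun a ha => ?_⟩
  obtain ⟨⟨l, hl, e⟩, h⟩ := h₂ a ha
  simp only [groupLits, List.mem_map] at hl
  obtain ⟨x, hx, rfl⟩ := hl
  simp only at e
  have h₃ : x.1.val / p ≤ φ.n / p := Nat.div_le_div_right x.1.isLt.le
  have h₄ : t * (x.1.val / p) ≤ t * (φ.n / p) := Nat.mul_le_mul_left _ h₃
  rw [← e, modSize, Nat.mul_add]
  omega

theorem mem_kvEdges (hq : 3 ≤ q) {e : ℕ × ℕ} (he : e ∈ φ.kvEdges D) :
    (e.1 < modSize q p t φ.n + (φ.pathVertices D).length ∧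
      e.2 < modSize q p t φ.n + (φ.pathVertices D).length) ∧ e.1 ≠ e.2 ∧
    (modSize q p t φ.n ≤ e.1 → modSize q p t φ.n ≤ e.2 → e.2 = e.1 + 1) := by
  have hb : q ≤ modSize q p t φ.n := Nat.le_add_right _ _
  rcases List.mem_append.1 he with he | he
  · have := mem_pathEdges_bounds hb (φ.closed_pathVertices D)
      (fun v hv => (φ.mem_pathVertices D hq hv).2) he
    omega
  · have := mem_paletteEdges.1 he
    omega

/-- The coloring instance for a formula. -/
noncomputable def kvInstance (hq : 3 ≤ q) : KvInstance IsLinearForest :=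
  listInstance (modSize q p t φ.n + (φ.pathVertices D).length) (modSize q p t φ.n) (φ.kvEdges D)
    (fun _ he => (φ.mem_kvEdges D hq he).1) (fun _ he => (φ.mem_kvEdges D hq he).2.1)
    (fun _ he => (φ.mem_kvEdges D hq he).2.2)

/-- The palette vertices get different colours, so the colours can be permuted in such a way that each
palette vertex gets its own. -/
theorem exists_normalized_coloring {n : ℕ} (hn : q ≤ n) {L : List (ℕ × ℕ)} (hL : paletteEdges q ⊆ L)
    (hlt : ∀ e ∈ L, e.1 < n ∧ e.2 < n) {col : ℕ → ℕ} (hcol : ∀ v < n, col v < q)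
    (hedge : ∀ e ∈ L, col e.1 ≠ col e.2) :
    ∃ col' : ℕ → ℕ, (∀ v < n, col' v < q) ∧ (∀ d < q, col' d = d) ∧
      ∀ e ∈ L, col' e.1 ≠ col' e.2 := by
  let σ : Fin q → Fin q := fun d => ⟨col d, hcol d (d.isLt.trans_le hn)⟩
  have hσ : Function.Injective σ := by
    intro c d h
    have h : col c = col d := Fin.mk.inj_iff.1 h
    rcases lt_trichotomy c d with hcd | hcd | hcd
    · exact absurd h (hedge (c, d) (hL (mem_paletteEdges.2 ⟨hcd, d.isLt⟩)))
    · exact hcd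
    · exact absurd h.symm (hedge (d, c) (hL (mem_paletteEdges.2 ⟨hcd, c.isLt⟩)))
  let π := Equiv.ofBijective σ (Finite.injective_iff_bijective.1 hσ)
  have hval : ∀ v (hv : v < n),
      (if h : col v < q then (π.symm ⟨col v, h⟩).val else 0) = (π.symm ⟨col v, hcol v hv⟩).val :=
    fun v hv => dif_pos _
  refine ⟨fun v => if h : col v < q then (π.symm ⟨col v, h⟩).val else 0, fun v hv => ?_,
    fun d hd => ?_, fun e he => ?_⟩
  · simp only
    rw [hval v hv]
    exact Fin.isLt _
  · simp only
    rw [hval d (hd.trans_le hn)]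
    have : π.symm (π ⟨d, hd⟩) = ⟨d, hd⟩ := π.symm_apply_apply _
    exact congrArg Fin.val this
  · simp only
    rw [hval _ (hlt e he).1, hval _ (hlt e he).2]
    intro h
    exact hedge e he (Fin.mk.inj_iff.1 (π.symm.injective (Fin.ext h)))

/-- The instance can be coloured if and only if the formula is satisfiable. -/
theorem kvInstance_colorable_iff (hq : 3 ≤ q) (hD : Function.Surjective D) (ht : 0 < t) :
    (φ.kvInstance D hq).G.Colorable q ↔ φ.Satisfiable := by
  have hb : q ≤ modSize q p t φ.n := Nat.le_add_right _ _
  rw [kvInstance, listInstance_colorable]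
  constructor
  · rintro ⟨col, hcol, hedge⟩
    obtain ⟨col, hcol, hpal, hedge⟩ := exists_normalized_coloring (hb.trans (Nat.le_add_right _ _))
      (List.subset_append_right _ _) (fun _ he => (φ.mem_kvEdges D hq he).1) hcol hedge
    have hE := extends_of_coloring col hpal (φ.pathVertices D) (modSize q p t φ.n) none
      (fun v _ hv => hcol v hv)
      (fun e he => Or.inr (φ.mem_kvEdges D hq (List.mem_append_left _ he)).1.2)
      (fun e he => hedge e (List.mem_append_left _ he)) (Or.inl rfl)
    let f : ℕ → Fin t → Fin q := fun g i =>
      if h : col (g + (q + i)) < q then ⟨col (g + (q + i)), h⟩ else ⟨0, by omega⟩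
    rw [pathVertices, extends_gadgets_iff D _ f] at hE
    · refine ⟨fun v => D (f (t * (v / p))) (Fin.ofNat p v), fun C hC => ?_⟩
      obtain ⟨l, hl, e⟩ := hE _ (List.mem_map_of_mem hC)
      simp only [groupLits, List.mem_map] at hl
      obtain ⟨x, hx, rfl⟩ := hl
      exact ⟨x, hx, e⟩
    · simp only [List.mem_map]
      rintro _ ⟨C, hC, rfl⟩ l hl i
      simp only [groupLits, List.mem_map] at hl
      obtain ⟨x, hx, rfl⟩ := hl
      have h : col (t * (x.1.val / p) + (q + i)) < q := by
        apply hcol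
        have h₃ : x.1.val / p ≤ φ.n / p := Nat.div_le_div_right x.1.isLt.le
        have h₄ : t * (x.1.val / p) ≤ t * (φ.n / p) := Nat.mul_le_mul_left _ h₃
        have := i.isLt
        rw [modSize, Nat.mul_add]
        omega
      simp only [f, dif_pos h]
  · rintro ⟨a, ha⟩
    choose f hf using fun γ : ℕ => hD fun x : Fin p =>
      if h : p * γ + x < φ.n then a ⟨p * γ + x, h⟩ else false
    let col : ℕ → ℕ := fun v =>
      if v < q then v else f ((v - q) / t) ⟨(v - q) % t, Nat.mod_lt _ ht⟩
    have hcolq : ∀ v, col v < q := fun v => by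
      simp only [col]
      split_ifs with h
      · exact h
      · exact Fin.isLt _
    have hpal : ∀ d < q, col d = d := fun d hd => if_pos hd
    have hcolf : ∀ γ (i : Fin t), col (t * γ + (q + i)) = f γ i := fun γ i => by
      have e : t * γ + (q + i) - q = t * γ + i := by omega
      have e₁ : (t * γ + i.val) / t = γ := by
        rw [Nat.mul_add_div ht, Nat.div_eq_of_lt i.isLt, Nat.add_zero]
      have e₂ : (t * γ + i.val) % t = i := by
        rw [Nat.mul_add_mod, Nat.mod_eq_of_lt i.isLt]
      simp only [col, if_neg (show ¬ t * γ + (q + i.val) < q by omega), e, e₁, e₂]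
    have hE : Extends (fun g i => col (g + (q + i))) none (φ.pathVertices D) := by
      rw [pathVertices, extends_gadgets_iff D _ fun g => f (g / t)]
      · simp only [List.mem_map]
        rintro _ ⟨C, hC, rfl⟩
        obtain ⟨l, hl, e⟩ := ha C hC
        refine ⟨_, List.mem_map_of_mem hl, ?_⟩
        simp only
        rw [Nat.mul_div_cancel_left _ ht, hf, ← e]
        have hx : p * (l.1.val / p) + (Fin.ofNat p l.1.val).val = l.1 := Nat.div_add_mod _ _
        simp only [hx, l.1.isLt, dif_pos]
      · simp only [List.mem_map]
        rintro _ ⟨C, hC, rfl⟩ l hl i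
        simp only [groupLits, List.mem_map] at hl
        obtain ⟨x, hx, rfl⟩ := hl
        simp only
        rw [hcolf, Nat.mul_div_cancel_left _ ht]
    obtain ⟨col', h₁, h₂, h₃, -⟩ := exists_coloring_of_extends hb (φ.pathVertices D)
      (fun v hv => (φ.mem_pathVertices D hq hv).2) (fun v hv => (φ.mem_pathVertices D hq hv).1)
      _ _ le_rfl col hpal (fun _ _ _ => rfl) _ hE
    refine ⟨col', fun v hv => ?_, fun e he => ?_⟩
    · by_cases hvb : v < modSize q p t φ.n
      · rw [h₁ v hvb]
        exact hcolq v
      · exact h₂ v (by omega) hv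
    · rcases List.mem_append.1 he with he | he
      · exact h₃ e he
      · have h := mem_paletteEdges.1 he
        rw [h₁ _ (by omega), h₁ _ (by omega), hpal _ h.2, hpal _ (h.1.trans h.2)]
        exact h.1.ne

end Instance

end BoundedCNF

/-! ### Running times of basic programs -/

namespace StackProg

open Function

variable {K X : Type} [DecidableEq K]

section Runs

variable {c d : StackProg K X} {s s₁ s₂ : Store K X} {T T₁ T₂ : ℕ}

theorem Runs.mono (h : Runs c s s₁ T₁) (hT : T₁ ≤ T₂) : Runs c s s₁ T₂ := by
  obtain ⟨t, ht, h⟩ := h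
  exact ⟨t, ht.trans hT, h⟩

theorem Runs.seq (h₁ : Runs c s s₁ T₁) (h₂ : Runs d s₁ s₂ T₂) : Runs (seq c d) s s₂ (T₁ + T₂) := by
  obtain ⟨t₁, ht₁, h₁⟩ := h₁
  obtain ⟨t₂, ht₂, h₂⟩ := h₂
  exact ⟨_, add_le_add ht₁ ht₂, .seq h₁ h₂⟩

theorem runs_push (k : K) (b : Bool) (x : X) (S : K → List Bool) :
    Runs (push k b) (x, S) (x, update S k (b :: S k)) 1 := ⟨1, le_rfl, .push k b (x, S)⟩

theorem runs_upd (f : X → X) (x : X) (S : K → List Bool) :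
    Runs (upd f) (x, S) (f x, S) 1 := ⟨1, le_rfl, .upd f (x, S)⟩

theorem runs_switch {c : X → StackProg K X} {x : X} {S : K → List Bool}
    (h : Runs (c x) (x, S) s T) : Runs (switch c) (x, S) s (T + 1) := by
  obtain ⟨t, ht, h⟩ := h
  exact ⟨_, Nat.succ_le_succ ht, .switch (s := (x, S)) h⟩

theorem runs_popCase {k : K} {c : Option Bool → StackProg K X} {x : X} {S : K → List Bool}
    {b : Bool} {l : List Bool} (hk : S k = b :: l)
    (h : Runs (c (some b)) (x, update S k l) s T) : Runs (popCase k c) (x, S) s (T + 1) := by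
  obtain ⟨t, ht, h⟩ := h
  refine ⟨_, Nat.succ_le_succ ht, .popCase ?_⟩
  simp only [hk]
  exact h

theorem runs_loop_exit {k : K} {go : Option Bool → Bool} {c : Option Bool → StackProg K X} {x : X}
    {S : K → List Bool} {l : List Bool} (hk : S k = l) (hgo : go l.head? = false) :
    Runs (loop k go c) (x, S) (x, update S k l.tail) 1 := by
  subst hk
  exact ⟨1, le_rfl, .loop_exit (s := (x, S)) hgo⟩

theorem runs_loop_step {k : K} {go : Option Bool → Bool} {c : Option Bool → StackProg K X} {x : X}
    {S : K → List Bool} {b : Bool} {l : List Bool} (hk : S k = b :: l) (hgo : go (some b) = true)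
    (h₁ : Runs (c (some b)) (x, update S k l) s₁ T₁) (h₂ : Runs (loop k go c) s₁ s₂ T₂) :
    Runs (loop k go c) (x, S) s₂ (T₁ + 1 + T₂) := by
  obtain ⟨t₁, ht₁, h₁⟩ := h₁
  obtain ⟨t₂, ht₂, h₂⟩ := h₂
  refine ⟨t₁ + 1 + t₂, by omega, .loop_step (s₂ := s₁) ?_ ?_ h₂⟩
  · simp only [hk]; exact hgo
  · simp only [hk]; exact h₁

end Runs

/-- Do nothing. -/
def skip : StackProg K X := upd id

/-- Push `n` copies of a bit. -/
def pushN (k : K) (b : Bool) : ℕ → StackProg K X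
  | 0 => skip
  | n + 1 => seq (pushN k b n) (push k b)

/-- Pop bits from a stack, and run `c` for each, as long as the popped bit is a one. -/
def whileTrue (k : K) (c : StackProg K X) : StackProg K X :=
  loop k (fun o => o == some true) fun _ => c

theorem runs_skip (s : Store K X) : Runs skip s s 1 := runs_upd id s.1 s.2

theorem runs_pushN (k : K) (b : Bool) (n : ℕ) (x : X) (S : K → List Bool) :
    Runs (pushN k b n) (x, S) (x, update S k (List.replicate n b ++ S k)) (n + 1) := by
  induction n with
  | zero => simpa [pushN] using runs_skip (x, S)
  | succ n ih => simpa [pushN, List.replicate_succ] using ih.seq (runs_push k b x _)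

/-- A loop over a unary number: `f i` is the store before the `i`-th test. -/
theorem runs_whileTrue {k : K} {c : StackProg K X} {T m : ℕ} {l : List Bool}
    (hl : l.head? ≠ some true) (f : ℕ → Store K X)
    (hk : ∀ i ≤ m, (f i).2 k = List.replicate (m - i) true ++ l)
    (hc : ∀ i < m, Runs c ((f i).1, update (f i).2 k (List.replicate (m - (i + 1)) true ++ l))
      (f (i + 1)) T) :
    Runs (whileTrue k c) (f 0) ((f m).1, update (f m).2 k l.tail) (m * (T + 1) + 1) := by
  suffices h : ∀ j ≤ m, Runs (whileTrue k c) (f (m - j)) ((f m).1, update (f m).2 k l.tail)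
      (j * (T + 1) + 1) by simpa using h m le_rfl
  intro j hj
  induction j with
  | zero =>
    rw [Nat.sub_zero, Nat.zero_mul]
    refine runs_loop_exit (by simpa using hk m le_rfl) ?_
    simpa using hl
  | succ j ih =>
    have e : m - (j + 1) + 1 = m - j := by omega
    have h := hk (m - (j + 1)) (by omega)
    rw [show m - (m - (j + 1)) = j + 1 by omega, List.replicate_succ, List.cons_append] at h
    have hb := hc (m - (j + 1)) (by omega)
    rw [e, show m - (m - j) = j by omega] at hb
    exact (runs_loop_step h rfl hb (ih (by omega))).mono (by rw [Nat.add_mul]; omega)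

/-- Pour a stack onto another one. -/
def pour (k k' : K) : StackProg K X := loop k Option.isSome fun o => push k' (o.getD false)

/-- Pouring reverses the word. -/
theorem runs_pour {k k' : K} (hkk : k ≠ k') (l : List Bool) (x : X) (S : K → List Bool)
    (hk : S k = l) :
    Runs (pour k k') (x, S) (x, update (update S k []) k' (l.reverse ++ S k')) (2 * l.length + 1) := by
  induction l generalizing S with
  | nil =>
    have h : Runs (pour k k') (x, S) (x, update S k []) 1 := runs_loop_exit hk rfl
    have : update S k' (S k') = S := update_eq_self _ _
    rw [update_comm hkk]
    simpa [this] using h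
  | cons b l ih =>
    have h := ih (update (update S k l) k' (b :: S k')) (by simp [hkk])
    have h' : Runs (push k' b) (x, update S k l) (x, update (update S k l) k' (b :: S k')) 1 := by
      simpa [update_of_ne hkk.symm] using runs_push k' b x (update S k l)
    have h'' : Runs (pour k k') (x, S) _ _ := runs_loop_step hk rfl h' h
    refine Runs.mono (T₁ := 1 + 1 + (2 * l.length + 1)) ?_ (by rw [List.length_cons]; omega)
    convert h'' using 2
    funext j
    simp only [update_apply]
    split_ifs <;> simp_all

/-- Empty a stack that holds a unary number, and run `push k' b` for each one that is popped. -/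
theorem runs_whileTrue_push {k k' : K} (hkk : k ≠ k') (b : Bool) (m : ℕ) (x : X)
    (S : K → List Bool) (hk : S k = List.replicate m true) :
    Runs (whileTrue k (push k' b)) (x, S)
      (x, update (update S k []) k' (List.replicate m b ++ S k')) (m * 2 + 1) := by
  have h := runs_whileTrue (k := k) (c := push k' b) (T := 1) (m := m) (l := []) (by simp)
    (fun i => (x, update (update S k (List.replicate (m - i) true)) k'
      (List.replicate i b ++ S k')))
    (fun i hi => by simp [hkk]) (fun i hi => by
      convert runs_push k' b x _ using 2
      funext j
      simp only [update_apply]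
      split_ifs <;> simp_all [List.replicate_succ])
  convert h using 2
  · funext j
    simp only [update_apply]
    split_ifs <;> simp_all
  · funext j
    simp only [update_apply]
    split_ifs <;> simp_all

end StackProg

/-! ### The program that writes the coloring instance -/

/-- The stacks of the reduction. -/
inductive Reg (s : ℕ) where
  /-- the input -/
  | inp
  /-- the list of edges -/
  | edges
  /-- auxiliary stack for copying -/
  | tmp
  /-- the output, written in reading order -/
  | out
  /-- the number of the present path vertex, in unary -/
  | cnt
  /-- the size of the modulator, in unary -/
  | base
  /-- the number of path vertices so far, in unary -/
  | num
  /-- the position of the group of the `j`-th literal of the present clause, in unary -/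
  | lit (j : Fin s)
deriving DecidableEq, Fintype

namespace Reg

open Function

variable {s : ℕ}

/-- The contents of the stacks while edges are being written: the rest of the input, the edges so
far, the size of the modulator, the number of path vertices so far, and the positions of the groups
of the literals. -/
def mem (i : List Bool) (E : List (ℕ × ℕ)) (b z : ℕ) (r : Fin s → ℕ) : Reg s → List Bool
  | inp => i
  | edges => listWord edgeWord E
  | tmp => []
  | out => []
  | cnt => List.replicate (b + z) true
  | base => List.replicate b true
  | num => List.replicate z true
  | lit j => List.replicate (r j) true

variable (i : List Bool) (E : List (ℕ × ℕ)) (b z : ℕ) (r : Fin s → ℕ)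

theorem update_mem_inp (l : List Bool) : update (mem i E b z r) inp l = mem l E b z r := by
  funext k; cases k <;> rfl

theorem update_mem_edges (E' : List (ℕ × ℕ)) :
    update (mem i E b z r) edges (listWord edgeWord E') = mem i E' b z r := by
  funext k; cases k <;> rfl

theorem update_mem_lit (j : Fin s) (m : ℕ) :
    update (mem i E b z r) (lit j) (List.replicate m true) = mem i E b z (update r j m) := by
  funext k
  cases k with
  | lit k =>
    by_cases h : k = j
    · subst h; simp [mem]
    · rw [update_of_ne (by simpa using h)]
      simp [mem, h]
  | _ => rfl

theorem update_mem_base (m : ℕ) :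
    update (update (mem i E b 0 r) base (List.replicate m true)) cnt (List.replicate m true) =
      mem i E m 0 r := by
  funext k; cases k <;> rfl

theorem update_mem_num :
    update (update (mem i E b z r) cnt (true :: mem i E b z r cnt)) num
      (true :: mem i E b z r num) = mem i E b (z + 1) r := by
  funext k; cases k <;> rfl

end Reg

namespace StackProg

open Function Reg PathVertex

variable {s : ℕ} {X : Type}

/-- Push a copy of a unary number onto the stack of edges. -/
def copyUnary (k : Reg s) : StackProg (Reg s) X :=
  seq (whileTrue k (seq (push .tmp true) (push .edges true))) (whileTrue .tmp (push k true))

theorem runs_copyUnary {k : Reg s} (h₁ : k ≠ .tmp) (h₂ : k ≠ .edges) (m : ℕ) (x : X)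
    (S : Reg s → List Bool) (hk : S k = List.replicate m true) (ht : S .tmp = []) :
    Runs (copyUnary k) (x, S) (x, update S .edges (List.replicate m true ++ S .edges))
      (5 * m + 2) := by
  have a := runs_whileTrue (k := k) (c := seq (push Reg.tmp true) (push Reg.edges true)) (T := 2)
    (m := m) (l := []) (by simp)
    (fun i => (x, update (update (update S .edges (List.replicate i true ++ S .edges)) .tmp
      (List.replicate i true)) k (List.replicate (m - i) true)))
    (fun i hi => by simp) (fun i hi => by
      convert (runs_push Reg.tmp true x _).seq (runs_push Reg.edges true x _) using 2
      funext j
      simp only [update_apply]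
      split_ifs <;> simp_all [List.replicate_succ])
  have b := runs_whileTrue_push (k := .tmp) (k' := k) h₁.symm true m x
    (update (update (update S .edges (List.replicate m true ++ S .edges)) .tmp
      (List.replicate m true)) k []) (by simp [h₁.symm])
  have e₁ : update (update (update S .edges (List.replicate 0 true ++ S .edges)) .tmp
      (List.replicate 0 true)) k (List.replicate (m - 0) true) = S := by
    funext j
    simp only [update_apply]
    split_ifs <;> simp_all
  rw [e₁] at a
  simp only [Nat.sub_self, List.replicate_zero, update_idem, List.tail_nil] at a
  have e₂ : update (update (update (update (update S .edges (List.replicate m true ++ S .edges))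
      .tmp (List.replicate m true)) k []) .tmp []) k (List.replicate m true ++
        update (update (update S .edges (List.replicate m true ++ S .edges)) .tmp
          (List.replicate m true)) k [] k) =
      update S .edges (List.replicate m true ++ S .edges) := by
    funext j
    simp only [update_apply]
    split_ifs <;> simp_all
  rw [e₂] at b
  exact (a.seq b).mono (by omega)

/-- Write the number of a vertex. -/
def emitAddr : Addr (Fin s) → StackProg (Reg s) X
  | .const n => seq (push .edges false) (pushN .edges true n)
  | .next n => seq (push .edges false) (seq (pushN .edges true n) (copyUnary .cnt))
  | .lit j n => seq (push .edges false) (seq (pushN .edges true n) (copyUnary (.lit j)))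

section Emit

variable (x : X) (i : List Bool) (E : List (ℕ × ℕ)) (b z : ℕ) (r : Fin s → ℕ)

theorem unaryWord_eq_append (m n : ℕ) (W : List Bool) :
    unaryWord (m + n) ++ W =
      List.replicate m true ++ (List.replicate n true ++ (false :: W)) := by
  rw [unaryWord, List.replicate_add, List.append_assoc, List.append_assoc]
  rfl

theorem runs_emitAddr (a : Addr (Fin s)) (W : List Bool) :
    Runs (emitAddr a) (x, update (mem i E b z r) .edges W)
      (x, update (mem i E b z r) .edges (unaryWord (a.eval r (b + z)) ++ W))
      (5 * (a.eval r (b + z) + 1)) := by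
  have h (n : ℕ) : Runs (X := X) (pushN Reg.edges true n)
      (x, update (mem i E b z r) .edges (false :: W))
      (x, update (mem i E b z r) .edges (List.replicate n true ++ false :: W)) (n + 1) := by
    simpa using runs_pushN Reg.edges true n x (update (mem i E b z r) .edges (false :: W))
  have h₀ : Runs (X := X) (push Reg.edges false) (x, update (mem i E b z r) .edges W)
      (x, update (mem i E b z r) .edges (false :: W)) 1 := by
    simpa using runs_push Reg.edges false x (update (mem i E b z r) .edges W)
  cases a with
  | const n =>
    refine (h₀.seq ?_).mono (show 1 + (n + 1) ≤ _ by simp only [Addr.eval]; omega)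
    simpa [Addr.eval, unaryWord] using h n
  | next n =>
    have h₂ := runs_copyUnary (k := .cnt) (by simp) (by simp) (b + z) x
      (update (mem i E b z r) .edges (List.replicate n true ++ false :: W)) rfl rfl
    refine (h₀.seq ((h n).seq (s₂ := (x, _)) ?_)).mono (show 1 + (n + 1 + (5 * (b + z) + 2)) ≤ _ by
      simp only [Addr.eval]; omega)
    rw [Addr.eval, unaryWord_eq_append]
    simpa using h₂
  | lit j n =>
    have h₂ := runs_copyUnary (k := .lit j) (by simp) (by simp) (r j) x
      (update (mem i E b z r) .edges (List.replicate n true ++ false :: W)) rfl rfl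
    refine (h₀.seq ((h n).seq (s₂ := (x, _)) ?_)).mono (show 1 + (n + 1 + (5 * (r j) + 2)) ≤ _ by
      simp only [Addr.eval]; omega)
    rw [Addr.eval, unaryWord_eq_append]
    simpa using h₂

/-- Write edges, the last one first. -/
def emitEdges : List (Addr (Fin s) × Addr (Fin s)) → StackProg (Reg s) X
  | [] => skip
  | e :: L => seq (emitEdges L) (seq (emitAddr e.2) (seq (emitAddr e.1) (push .edges true)))

theorem listWord_cons {α : Type} (enc : α → List Bool) (a : α) (L : List α) :
    listWord enc (a :: L) = true :: (enc a ++ listWord enc L) := by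
  simp [listWord]

theorem runs_emitEdges_of_le (L : List (Addr (Fin s) × Addr (Fin s))) {R : ℕ}
    (hR : ∀ e ∈ L, e.1.eval r (b + z) ≤ R ∧ e.2.eval r (b + z) ≤ R) :
    Runs (emitEdges L) (x, mem i E b z r)
      (x, mem i (L.map (Prod.map (Addr.eval r (b + z)) (Addr.eval r (b + z))) ++ E) b z r)
      (L.length * (11 * (R + 1)) + 1) := by
  induction L with
  | nil => exact (runs_skip _).mono (by simp)
  | cons e L ih =>
    obtain ⟨he, hR⟩ := List.forall_mem_cons.1 hR
    set E' := L.map (Prod.map (Addr.eval r (b + z)) (Addr.eval r (b + z))) ++ E with hE'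
    have h₁ := runs_emitAddr x i E' b z r e.2 (listWord edgeWord E')
    have h₂ := runs_emitAddr x i E' b z r e.1
      (unaryWord (e.2.eval r (b + z)) ++ listWord edgeWord E')
    have h₃ := runs_push Reg.edges true x (update (mem i E' b z r) .edges
      (unaryWord (e.1.eval r (b + z)) ++
        (unaryWord (e.2.eval r (b + z)) ++ listWord edgeWord E')))
    rw [update_mem_edges] at h₁
    rw [update_idem, update_self] at h₃
    refine ((ih hR).seq (h₁.seq (h₂.seq (s₂ := (x, _)) ?_))).mono
      (show _ + (_ + (_ + 1)) ≤ _ by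
        rw [List.length_cons, Nat.add_mul, Nat.one_mul]
        omega)
    rw [List.map_cons, List.cons_append, ← hE', ← update_mem_edges i E' b z r (_ :: E'),
      listWord_cons,
      edgeWord, List.append_assoc]
    exact h₃

/-- The largest offset in an address. -/
def offset : Addr (Fin s) → ℕ
  | .const n => n
  | .next n => n
  | .lit _ n => n

theorem runs_emitEdges (L : List (Addr (Fin s) × Addr (Fin s))) : ∃ A : ℕ,
    ∀ (x : X) (i : List Bool) (E : List (ℕ × ℕ)) (b z : ℕ) (r : Fin s → ℕ) (R : ℕ),
      b + z ≤ R → (∀ j, r j ≤ R) → Runs (emitEdges L) (x, mem i E b z r)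
        (x, mem i (L.map (Prod.map (Addr.eval r (b + z)) (Addr.eval r (b + z))) ++ E) b z r)
        (A * (R + 1)) := by
  let o := (L.map fun e => offset e.1 + offset e.2).sum
  refine ⟨L.length * (11 * (o + 1)) + 1, fun x i E b z r R hb hr => ?_⟩
  have ha (a : Addr (Fin s)) : a.eval r (b + z) ≤ R + offset a := by
    cases a with
    | const n => simp [Addr.eval, offset]
    | next n => simp only [Addr.eval, offset]; omega
    | lit j n => have := hr j; simp only [Addr.eval, offset]; omega
  refine (runs_emitEdges_of_le x i E b z r L (R := R + o) fun e he => ?_).mono ?_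
  · have ho : offset e.1 + offset e.2 ≤ o :=
      List.single_le_sum (fun _ _ => Nat.zero_le _) _ (List.mem_map_of_mem he)
    have h₁ := ha e.1
    have h₂ := ha e.2
    omega
  · have : R + o + 1 ≤ (o + 1) * (R + 1) := by
      have := Nat.zero_le (o * R)
      nlinarith
    calc L.length * (11 * (R + o + 1)) + 1
        ≤ L.length * (11 * ((o + 1) * (R + 1))) + (R + 1) := by gcongr; omega
      _ = _ := by ring

/-- Write the edges of consecutive path vertices. -/
def emitVertices (q : ℕ) : List (PathVertex (Fin s)) → StackProg (Reg s) X
  | [] => skip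
  | v :: V => seq (emitEdges (v.edges q))
      (seq (push .cnt true) (seq (push .num true) (emitVertices q V)))

theorem runs_emitVertices (q : ℕ) (V : List (PathVertex (Fin s))) : ∃ A : ℕ,
    ∀ (x : X) (i : List Bool) (E : List (ℕ × ℕ)) (b z : ℕ) (r : Fin s → ℕ) (R : ℕ),
      b + z + V.length ≤ R → (∀ j, r j ≤ R) → Runs (emitVertices q V) (x, mem i E b z r)
        (x, mem i (pathEdges q r (b + z) V ++ E) b (z + V.length) r) (A * (R + 1)) := by
  induction V with
  | nil => exact ⟨1, fun x i E b z r R _ _ => (runs_skip _).mono (by omega)⟩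
  | cons v V ih =>
    obtain ⟨A, hA⟩ := runs_emitEdges (X := X) (v.edges q)
    obtain ⟨B, hB⟩ := ih
    refine ⟨A + 2 + B, fun x i E b z r R hR hr => ?_⟩
    rw [List.length_cons] at hR
    have h₁ := hA x i E b z r R (by omega) hr
    have h₂ := hB x i ((v.edges q).map (Prod.map (Addr.eval r (b + z)) (Addr.eval r (b + z))) ++ E)
      b (z + 1) r R (by omega) hr
    rw [← update_mem_num] at h₂
    refine (h₁.seq ((runs_push _ _ _ _).seq ((runs_push _ _ _ _).seq (s₂ := (x, _)) ?_))).mono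
      (show A * (R + 1) + (1 + (1 + B * (R + 1))) ≤ _ by nlinarith)
    rw [PathVertex.pathEdges, List.append_assoc, List.length_cons, Nat.add_comm V.length 1,
      ← Nat.add_assoc z]
    exact h₂

end Emit

end StackProg

/-! ### Reading the formula -/

namespace StackProg

open Function Reg PathVertex BoundedCNF

variable {s p : ℕ} [NeZero p]

/-- Count modulo `p` in the control value, and run `c` whenever the count wraps around. -/
def tick (c : StackProg (Reg s) (Fin p)) : StackProg (Reg s) (Fin p) :=
  seq (upd fun x => x + 1) (switch fun x => if x = 0 then c else skip)

/-- Read a unary number `v`: leave `v % p` in the control value, and run `c` for `v / p` times. -/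
def readDivMod (c : StackProg (Reg s) (Fin p)) : StackProg (Reg s) (Fin p) :=
  seq (upd fun _ => 0) (whileTrue .inp (tick c))

/-- Here `f a l` describes the stacks with the rest `l` of the input after `a` runs of `c`. -/
theorem runs_readDivMod {c : StackProg (Reg s) (Fin p)} {T : ℕ} (hT : 1 ≤ T)
    (f : ℕ → List Bool → Reg s → List Bool) (hf : ∀ a l, f a l .inp = l)
    (hf' : ∀ a l l', update (f a l) .inp l' = f a l')
    (hc : ∀ a l x, Runs c (x, f a l) (x, f (a + 1) l) T) (v : ℕ) (l : List Bool) (x : Fin p) :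
    Runs (readDivMod c) (x, f 0 (unaryWord v ++ l)) (Fin.ofNat p v, f (v / p) l)
      (v * (T + 3) + 2) := by
  have h := runs_whileTrue (k := Reg.inp) (c := tick c) (T := T + 2) (m := v) (l := false :: l)
    (by simp) (fun i => (Fin.ofNat p i, f (i / p) (List.replicate (v - i) true ++ false :: l)))
    (fun i _ => by simp only [hf]) (fun i hi => by
      simp only [hf']
      have e : (Fin.ofNat p i + 1 : Fin p) = Fin.ofNat p (i + 1) := by
        rw [Fin.ext_iff, Fin.val_add, Fin.val_ofNat, Fin.val_ofNat]
        exact (Nat.add_mod _ _ _).symm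
      have e₀ : Fin.ofNat p (i + 1) = 0 ↔ p ∣ i + 1 := by
        rw [Fin.ext_iff, Fin.val_ofNat, Fin.val_zero, Nat.dvd_iff_mod_eq_zero]
      refine ((runs_upd _ _ _).seq (T₂ := T + 1) ?_).mono (by omega)
      rw [e]
      refine runs_switch ?_
      rw [Nat.succ_div]
      by_cases hd : p ∣ i + 1
      · rw [if_pos (e₀.2 hd), if_pos hd]
        exact hc _ _ _
      · rw [if_neg (mt e₀.1 hd), if_neg hd]
        exact (runs_skip _).mono hT)
  simp only [hf', List.tail_cons, Nat.sub_zero, Nat.zero_div] at h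
  have e : unaryWord v ++ l = List.replicate v true ++ false :: l := by simp [unaryWord]
  rw [e]
  refine ((runs_upd _ _ _).seq (s₂ := (_, _)) ?_).mono (show 1 + (v * (T + 2 + 1) + 1) ≤ _ by
    rw [Nat.add_assoc T]; omega)
  exact h

/-- Read the number of a variable, and store the position of its group. -/
theorem runs_readDivMod_lit (t : ℕ) (j : Fin s) (v : ℕ) (l : List Bool) (x : Fin p)
    (E : List (ℕ × ℕ)) (b z : ℕ) (r : Fin s → ℕ) (hr : r j = 0) :
    Runs (readDivMod (pushN (.lit j) true t)) (x, mem (unaryWord v ++ l) E b z r)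
      (Fin.ofNat p v, mem l E b z (update r j (t * (v / p)))) (v * (t + 4) + 2) := by
  have h := runs_readDivMod (c := pushN (.lit j) true t) (T := t + 1) (by omega)
    (fun a l => mem l E b z (update r j (t * a))) (fun _ _ => rfl)
    (fun a l l' => update_mem_inp _ _ _ _ _ _) (fun a l x => by
      convert runs_pushN (Reg.lit j) true t x (mem l E b z (update r j (t * a))) using 2
      have : List.replicate t true ++ mem l E b z (update r j (t * a)) (.lit j) =
          List.replicate (t * (a + 1)) true := by
        simp [mem, List.replicate_append_replicate, Nat.mul_add, Nat.add_comm]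
      rw [this, update_mem_lit, update_idem]) v l x
  simp only [Nat.mul_zero] at h
  rwa [show update r j 0 = r from update_eq_self_iff.2 hr.symm] at h

/-- The word of a literal. -/
def litWord {n : ℕ} (l : Fin n × Bool) : List Bool := unaryWord l.1 ++ [l.2]

variable {q t : ℕ} (D : (Fin t → Fin q) → Fin p → Bool)

/-- Read the rest of a clause and write the edges of its paths. The literals `τ` have been read; the
next ones are to be stored in the registers `J`. -/
noncomputable def readClause : List (Fin s) → List (Fin s × Fin p × Bool) →
    StackProg (Reg s) (Fin p)
  | [], τ => popCase .inp fun _ => emitVertices q (gadget D τ)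
  | j :: J, τ => popCase .inp fun o =>
      if o = some true then
        seq (readDivMod (pushN (.lit j) true t)) <|
          popCase .inp fun sg => switch fun x => readClause J (τ ++ [(j, x, sg.getD false)])
      else emitVertices q (gadget D τ)

omit [NeZero p] in
theorem runs_emitVertices_gadget (τ : List (Fin s × Fin p × Bool)) : ∃ A : ℕ,
    ∀ (x : Fin p) (i : List Bool) (E : List (ℕ × ℕ)) (b z : ℕ) (r : Fin s → ℕ) (R : ℕ),
      b + z + (gadget D (τ.map (Prod.map r id))).length ≤ R → (∀ j, r j ≤ R) →
      Runs (emitVertices q (gadget D τ)) (x, mem i E b z r)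
        (x, mem i (pathEdges q id (b + z) (gadget D (τ.map (Prod.map r id))) ++ E) b
          (z + (gadget D (τ.map (Prod.map r id))).length) r) (A * (R + 1)) := by
  obtain ⟨A, hA⟩ := runs_emitVertices (X := Fin p) q (gadget D τ)
  refine ⟨A, fun x i E b z r R hR hr => ?_⟩
  rw [map_gadget, List.length_map] at hR ⊢
  rw [pathEdges_map]
  exact hA x i E b z r R hR hr

/-- The literals `C` are still to be read. The constant `A` works for all formulas, because the
gadgets depend on the registers only through the names of the groups. -/
theorem runs_readClause (J : List (Fin s)) (hJ : J.Nodup) (τ : List (Fin s × Fin p × Bool))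
    (hτ : ∀ l ∈ τ, l.1 ∉ J) : ∃ A : ℕ, ∀ (n : ℕ) (C : List (Fin n × Bool)), C.length ≤ J.length →
      ∀ (x : Fin p) (i : List Bool) (E : List (ℕ × ℕ)) (b z : ℕ) (r : Fin s → ℕ)
        (V : List (PathVertex ℕ)) (R : ℕ),
        V = gadget D (τ.map (Prod.map r id) ++ groupLits p t C) → (∀ j ∈ J, r j = 0) →
        b + z + V.length ≤ R → (∀ j, r j ≤ R) → n ≤ R → t * (n / p) ≤ R →
        ∃ (x' : Fin p) (r' : Fin s → ℕ), (∀ j, r' j ≤ R) ∧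
          Runs (readClause D J τ) (x, mem (listWord litWord C ++ i) E b z r)
            (x', mem i (pathEdges q id (b + z) V ++ E) b (z + V.length) r') (A * (R + 1)) := by
  induction J generalizing τ with
  | nil =>
    obtain ⟨A, hA⟩ := runs_emitVertices_gadget D τ
    refine ⟨A + 1, fun n C hC x i E b z r V R hV _ hR hr _ _ => ⟨x, r, hr, ?_⟩⟩
    obtain rfl : C = [] := List.length_eq_zero_iff.1 (by simpa using hC)
    simp only [groupLits, List.map_nil, List.append_nil] at hV
    subst hV
    rw [readClause]
    refine (runs_popCase (T := A * (R + 1)) (b := false) (l := i) (by rfl) ?_).mono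
      (by rw [Nat.add_mul]; omega)
    rw [update_mem_inp]
    exact hA x i E b z r R hR hr
  | cons j J ih =>
    obtain ⟨hjJ, hJ⟩ := List.nodup_cons.1 hJ
    obtain ⟨A, hA⟩ := runs_emitVertices_gadget D τ
    have hτ' : ∀ (y : Fin p × Bool), ∀ l ∈ τ ++ [(j, y)], l.1 ∉ J := by
      intro y l hl
      rcases List.mem_append.1 hl with hl | hl
      · exact fun h => hτ l hl (List.mem_cons_of_mem _ h)
      · rw [List.mem_singleton.1 hl]
        exact hjJ
    choose B hB using fun y : Fin p × Bool => ih hJ (τ ++ [(j, y)]) (hτ' y)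
    refine ⟨A + 1 + (t + 4 + 5 + ∑ y, B y), fun n C hC x i E b z r V R hV hrJ hR hr hn hnp => ?_⟩
    have hB' : ∀ y, B y ≤ ∑ y, B y := fun y =>
      Finset.single_le_sum (fun _ _ => Nat.zero_le _) (Finset.mem_univ y)
    rcases C with _ | ⟨⟨v, sg⟩, C⟩
    · refine ⟨x, r, hr, ?_⟩
      simp only [groupLits, List.map_nil, List.append_nil] at hV
      subst hV
      rw [readClause]
      refine (runs_popCase (T := A * (R + 1)) (b := false) (l := i) (by rfl) ?_).mono
        (by rw [Nat.add_mul, Nat.add_mul]; omega)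
      rw [update_mem_inp, if_neg (by simp)]
      exact hA x i E b z r R hR hr
    · set r₁ := update r j (t * (v.val / p)) with hr₁
      have hvR : t * (v.val / p) ≤ R :=
        (Nat.mul_le_mul_left t (Nat.div_le_div_right v.isLt.le)).trans hnp
      have hmap : τ.map (Prod.map r₁ id) = τ.map (Prod.map r id) := by
        refine List.map_congr_left fun l hl => ?_
        have : l.1 ≠ j := fun h => hτ l hl (h ▸ List.mem_cons_self)
        simp [Prod.map, hr₁, this]
      obtain ⟨x', r', hr', hrun⟩ := hB (Fin.ofNat p v, sg) n C (by simpa using hC)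
        (Fin.ofNat p v) i E b z r₁ V R (by
          rw [hV, List.map_append, hmap, List.append_assoc]
          simp [groupLits, hr₁])
        (fun k hk => by
          have : k ≠ j := fun h => hjJ (h ▸ hk)
          rw [hr₁, update_of_ne this]
          exact hrJ k (List.mem_cons_of_mem _ hk))
        hR (fun k => by
          rw [hr₁, update_apply]
          split_ifs
          · exact hvR
          · exact hr k) hn hnp
      refine ⟨x', r', hr', ?_⟩
      have hw : listWord litWord ((v, sg) :: C) ++ i =
          true :: (unaryWord v ++ (sg :: (listWord litWord C ++ i))) := by
        simp [listWord_cons, litWord]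
      rw [hw]
      have h₁ := runs_readDivMod_lit t j v (sg :: (listWord litWord C ++ i)) x E b z r
        (hrJ j List.mem_cons_self)
      rw [readClause]
      refine (runs_popCase (T := v.val * (t + 4) + 2 +
        (B (Fin.ofNat p v, sg) * (R + 1) + 1 + 1)) (by rfl) ?_).mono ?_
      · rw [update_mem_inp, if_pos rfl]
        refine h₁.seq (runs_popCase (by rfl) ?_)
        rw [update_mem_inp]
        exact runs_switch hrun
      · have h₂ := hB' (Fin.ofNat p v, sg)
        have h₃ : v.val * (t + 4) ≤ R * (t + 4) := Nat.mul_le_mul_right _ (v.isLt.le.trans hn)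
        have h₄ := Nat.mul_le_mul_right (R + 1) h₂
        have h₅ := Nat.zero_le (A * (R + 1))
        nlinarith

/-- Empty the registers of the literals. -/
def clearLits : List (Fin s) → StackProg (Reg s) (Fin p)
  | [] => skip
  | j :: J => seq (whileTrue (.lit j) skip) (clearLits J)

omit [NeZero p] in
theorem runs_clearLits (J : List (Fin s)) (x : Fin p) (i : List Bool) (E : List (ℕ × ℕ))
    (b z : ℕ) (r : Fin s → ℕ) (R : ℕ) (hr : ∀ j, r j ≤ R) :
    Runs (clearLits J) (x, mem i E b z r) (x, mem i E b z fun j => if j ∈ J then 0 else r j)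
      ((2 * J.length + 1) * (R + 1)) := by
  induction J generalizing r with
  | nil => simpa [clearLits] using (runs_skip (x, mem i E b z r)).mono (show 1 ≤ R + 1 by omega)
  | cons j J ih =>
    have h := runs_whileTrue (k := Reg.lit j) (c := (skip : StackProg (Reg s) (Fin p))) (T := 1)
      (m := r j) (l := []) (by simp)
      (fun k => (x, mem i E b z (update r j (r j - k)))) (fun k _ => by simp [mem])
      (fun k _ => by
        rw [List.append_nil, update_mem_lit, update_idem]
        exact runs_skip _)
    have h' := ih (update r j 0) fun k => by
      rw [update_apply]
      split_ifs
      · exact Nat.zero_le _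
      · exact hr k
    simp only [Nat.sub_zero, update_eq_self, Nat.sub_self, List.tail_nil] at h
    rw [show ([] : List Bool) = List.replicate 0 true from rfl, update_mem_lit, update_idem] at h
    refine Runs.mono (T₁ := r j * (1 + 1) + 1 + (2 * J.length + 1) * (R + 1)) ?_ ?_
    · have e : (fun k => if k ∈ j :: J then 0 else r k) =
          fun k => if k ∈ J then 0 else update r j 0 k := by
        funext k
        by_cases hk : k = j
        · subst hk; simp
        · simp [hk]
      rw [e]
      exact h.seq h'
    · have := hr j
      rw [List.length_cons]
      nlinarith

/-- Read a list of clauses and write the edges of their paths. -/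
noncomputable def readClauses (s : ℕ) : StackProg (Reg s) (Fin p) :=
  whileTrue .inp (seq (readClause D (List.finRange s) []) (clearLits (List.finRange s)))

theorem runs_readClauses : ∃ A : ℕ, ∀ (n : ℕ) (Cs : List (List (Fin n × Bool))),
    (∀ C ∈ Cs, C.length ≤ s) → ∀ (x : Fin p) (i : List Bool) (E : List (ℕ × ℕ)) (b z : ℕ)
      (V : List (PathVertex ℕ)) (R : ℕ), V = (Cs.map (groupLits p t)).flatMap (gadget D) →
      b + z + V.length ≤ R → n ≤ R → t * (n / p) ≤ R →
      ∃ x' : Fin p, Runs (readClauses D s)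
        (x, mem (listWord (listWord litWord) Cs ++ i) E b z fun _ => 0)
        (x', mem i (pathEdges q id (b + z) V ++ E) b (z + V.length) fun _ => 0)
        ((Cs.length + 1) * (A * (R + 1))) := by
  obtain ⟨A, hA⟩ := runs_readClause D (List.finRange s) (List.nodup_finRange s) [] (by simp)
  refine ⟨A + (2 * s + 1) + 1, fun n Cs => ?_⟩
  induction Cs with
  | nil =>
    intro _ x i E b z V R hV _ _ _
    have hV : V = [] := hV
    subst hV
    have h : Runs (readClauses D s) (x, mem (false :: i) E b z fun _ => 0)
        (x, update (mem (false :: i) E b z fun _ => 0) .inp i) 1 := runs_loop_exit rfl rfl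
    rw [update_mem_inp] at h
    exact ⟨x, h.mono (by simp only [List.length_nil]; nlinarith)⟩
  | cons C Cs ih =>
    intro hCs x i E b z V R hV hR hn hnp
    obtain ⟨hC, hCs⟩ := List.forall_mem_cons.1 hCs
    rw [List.map_cons, List.flatMap_cons] at hV
    set V₁ := gadget D (groupLits p t C)
    set V₂ := (Cs.map (groupLits p t)).flatMap (gadget D)
    subst hV
    rw [List.length_append] at hR ⊢
    obtain ⟨x₁, r, hr, h₁⟩ := hA n C (by simpa using hC) x (listWord (listWord litWord) Cs ++ i) E b
      z (fun _ => 0) V₁ R rfl (fun _ _ => rfl) (by omega) (fun _ => Nat.zero_le _) hn hnp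
    have h₂ := runs_clearLits (List.finRange s) x₁ (listWord (listWord litWord) Cs ++ i)
      (pathEdges q id (b + z) V₁ ++ E) b (z + V₁.length) r R hr
    simp only [List.mem_finRange, if_true, List.length_finRange] at h₂
    obtain ⟨x₂, h₃⟩ := ih hCs x₁ i (pathEdges q id (b + z) V₁ ++ E) b (z + V₁.length) V₂ R rfl
      (by omega) hn hnp
    refine ⟨x₂, ?_⟩
    rw [listWord_cons, List.cons_append, pathEdges_append, List.append_assoc, List.append_assoc,
      ← Nat.add_assoc z]
    rw [← Nat.add_assoc b] at h₃
    refine Runs.mono (T₁ := A * (R + 1) + (2 * s + 1) * (R + 1) + 1 + (Cs.length + 1) *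
      ((A + (2 * s + 1) + 1) * (R + 1))) ?_ ?_
    · refine runs_loop_step (b := true) (by rfl) (by rfl) ?_ h₃
      rw [update_mem_inp]
      exact h₁.seq h₂
    · rw [List.length_cons]
      nlinarith

end StackProg

/-! ### The reduction runs in quadratic time -/

namespace StackProg

open Function Reg PathVertex BoundedCNF

variable {s p q t : ℕ} [NeZero p]

/-- Write the edges of the palette, and compute the size of the modulator while reading the number
of variables. -/
def readHeader (q t : ℕ) : StackProg (Reg s) (Fin p) :=
  seq (push .edges false) <| seq (emitEdges ((paletteEdges q).map (Prod.map .const .const))) <|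
    seq (seq (pushN .base true (q + t)) (pushN .cnt true (q + t))) <|
      readDivMod (seq (pushN .base true t) (pushN .cnt true t))

omit [NeZero p] in
theorem runs_pushN_base_cnt (m b : ℕ) (x : Fin p) (i : List Bool) (E : List (ℕ × ℕ))
    (r : Fin s → ℕ) :
    Runs (seq (pushN .base true m) (pushN .cnt true m)) (x, mem i E b 0 r)
      (x, mem i E (m + b) 0 r) (2 * m + 2) := by
  have h₁ := runs_pushN Reg.base true m x (mem i E b 0 r)
  have h₂ := runs_pushN Reg.cnt true m x
    (update (mem i E b 0 r) .base (List.replicate m true ++ mem i E b 0 r .base))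
  have e₁ : List.replicate m true ++ mem i E b 0 r .base = List.replicate (m + b) true :=
    List.replicate_append_replicate
  have e₂ : List.replicate m true ++ mem i E b 0 r .cnt = List.replicate (m + b) true :=
    List.replicate_append_replicate
  rw [update_of_ne (by simp), e₂, e₁, update_mem_base] at h₂
  rw [e₁] at h₁
  exact (h₁.seq h₂).mono (by omega)

theorem runs_readHeader (s p q t : ℕ) [NeZero p] : ∃ A : ℕ, ∀ (n : ℕ) (x : Fin p) (l : List Bool),
    Runs (readHeader (s := s) q t) (single x .inp (unaryWord n ++ l))
      (Fin.ofNat p n, mem l (paletteEdges q) (modSize q p t n) 0 fun _ => 0) (A * (n + 1)) := by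
  obtain ⟨A, hA⟩ := runs_emitEdges (s := s) (X := Fin p)
    ((paletteEdges q).map (Prod.map .const .const))
  refine ⟨1 + A + 2 * (q + t) + 2 + (2 * t + 7), fun n x l => ?_⟩
  have h₁ : Runs (push .edges false) (single x .inp (unaryWord n ++ l))
      ((x, mem (unaryWord n ++ l) [] 0 0 (fun _ => 0)) : Store (Reg s) (Fin p)) 1 := by
    have e : update (single x .inp (unaryWord n ++ l)).2 .edges [false] =
        mem (unaryWord n ++ l) [] 0 0 fun _ : Fin s => 0 := by
      funext k; cases k <;> rfl
    rw [← e]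
    exact runs_push Reg.edges false x _
  have h₂ := hA x (unaryWord n ++ l) [] 0 0 (fun _ => 0) 0 le_rfl fun _ => le_rfl
  have e : ((paletteEdges q).map (Prod.map .const .const)).map
      (Prod.map (Addr.eval (fun _ : Fin s => 0) (0 + 0)) (Addr.eval (fun _ : Fin s => 0) (0 + 0))) =
      paletteEdges q := by
    rw [List.map_map]
    exact List.map_id _
  rw [e, List.append_nil] at h₂
  have h₃ := runs_pushN_base_cnt (q + t) 0 x (unaryWord n ++ l) (paletteEdges q)
    fun _ : Fin s => 0
  have h₄ := runs_readDivMod (c := seq (pushN .base true t) (pushN .cnt true t)) (T := 2 * t + 2)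
    (by omega) (fun a l => mem l (paletteEdges q) (q + t * (a + 1)) 0 fun _ : Fin s => 0)
    (fun _ _ => rfl) (fun a l l' => update_mem_inp _ _ _ _ _ _) (fun a l x => by
      convert runs_pushN_base_cnt t (q + t * (a + 1)) x l (paletteEdges q) (fun _ : Fin s => 0)
        using 3
      ring) n l x
  rw [Nat.zero_add, Nat.mul_one] at h₄
  refine (h₁.seq (h₂.seq (h₃.seq h₄))).mono ?_
  nlinarith

/-- Write the output: the number of vertices, the edges, and the characteristic vector of the
modulator. All other stacks are emptied on the way. -/
def writeOutput : StackProg (Reg s) (Fin p) :=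
  seq (whileTrue .cnt (push .out true)) <| seq (push .out false) <| seq (pour .edges .out) <|
    seq (whileTrue .base (push .out true)) <| seq (whileTrue .num (push .out false)) <|
      upd fun _ => 0

theorem runs_writeOutput (x : Fin p) (E : List (ℕ × ℕ)) (b z : ℕ) :
    Runs (writeOutput (s := s)) (x, mem [] E b z fun _ => 0)
      (single 0 .out (unaryWord (b + z) ++ listWord edgeWord E ++
        (List.replicate b true ++ List.replicate z false)).reverse)
      (4 * (b + z) + 2 * (listWord edgeWord E).length + 6) := by
  have h₁ := runs_whileTrue_push (k := Reg.cnt) (k' := .out) (by simp) true (b + z) x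
    (mem [] E b z fun _ : Fin s => 0) rfl
  set S₁ := update (update (mem [] E b z fun _ : Fin s => 0) .cnt []) .out
    (List.replicate (b + z) true ++ mem [] E b z (fun _ : Fin s => 0) .out) with hS₁
  have h₂ := runs_push .out false x S₁
  set S₂ := update S₁ .out (false :: S₁ .out) with hS₂
  have h₃ := runs_pour (k := Reg.edges) (k' := .out) (by simp) (listWord edgeWord E) x S₂ rfl
  set S₃ := update (update S₂ .edges []) .out ((listWord edgeWord E).reverse ++ S₂ .out) with hS₃
  have h₄ := runs_whileTrue_push (k := Reg.base) (k' := .out) (by simp) true b x S₃ rfl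
  set S₄ := update (update S₃ .base []) .out (List.replicate b true ++ S₃ .out) with hS₄
  have h₅ := runs_whileTrue_push (k := Reg.num) (k' := .out) (by simp) false z x S₄ rfl
  set S₅ := update (update S₄ .num []) .out (List.replicate z false ++ S₄ .out) with hS₅
  have e : S₅ = update (fun _ => []) .out (unaryWord (b + z) ++ listWord edgeWord E ++
      (List.replicate b true ++ List.replicate z false)).reverse := by
    funext k
    cases k with
    | out => simp [hS₅, hS₄, hS₃, hS₂, hS₁, unaryWord, mem]
    | _ => rfl
  have h := h₁.seq (h₂.seq (h₃.seq (h₄.seq (h₅.seq (runs_upd (fun _ => (0 : Fin p)) x S₅)))))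
  rw [e] at h
  exact h.mono (by omega)

variable (D : (Fin t → Fin q) → Fin p → Bool)

/-- The program that turns the word of a formula into the word of its coloring instance, where `D`
decodes colourings of a group to assignments of its variables. -/
noncomputable def reduction (s : ℕ) : StackProg (Reg s) (Fin p) :=
  seq (seq (readHeader q t) (readClauses D s)) writeOutput

theorem length_listWord {α : Type} (enc : α → List Bool) (L : List α) :
    L.length + 1 ≤ (listWord enc L).length := by
  induction L with
  | nil => simp [listWord]
  | cons a L ih =>
    rw [listWord_cons]
    simp only [List.length_cons, List.length_append]
    omega

theorem exists_length_gadget_le (s : ℕ) : ∃ A : ℕ, ∀ (n : ℕ) (C : List (Fin n × Bool)),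
    C.length ≤ s → (gadget D (groupLits p t C)).length ≤ A := by
  -- the number of vertices depends only on positions and signs, and there are finitely many of them
  obtain ⟨A, hA⟩ := ((List.finite_length_le (Unit × Fin p × Bool) s).image
    fun τ => (gadget D τ).length).bddAbove
  refine ⟨A, fun n C hC => ?_⟩
  have h := hA ⟨(groupLits p t C).map (Prod.map (fun _ => ()) id), ?_, rfl⟩
  · simpa only [map_gadget, List.length_map] using h
  · simpa [groupLits] using hC

theorem exists_length_pathVertices_le (s : ℕ) : ∃ A : ℕ, ∀ φ : BoundedCNF s,
    (φ.pathVertices D).length ≤ A * φ.clauses.length := by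
  obtain ⟨A, hA⟩ := exists_length_gadget_le D s
  refine ⟨A, fun φ => ?_⟩
  have key : ∀ Cs : List (List (Fin φ.n × Bool)), (∀ C ∈ Cs, C.length ≤ s) →
      ((Cs.map (groupLits p t)).flatMap (gadget D)).length ≤ A * Cs.length := by
    intro Cs hCs
    induction Cs with
    | nil => simp
    | cons C Cs ih =>
      obtain ⟨hC, hCs⟩ := List.forall_mem_cons.1 hCs
      have h₁ := ih hCs
      have h₂ := hA _ C hC
      rw [List.map_cons, List.flatMap_cons, List.length_append, List.length_cons, Nat.mul_succ]
      omega
  exact key _ φ.size_le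

theorem runs_reduction (s : ℕ) (hq : 3 ≤ q) : ∃ T : ℕ, ∀ φ : BoundedCNF s,
    Runs (reduction D s) (single 0 .inp φ.encode)
      (single 0 .out (φ.kvInstance D hq).encode.reverse) (T * φ.encode.length ^ 2) := by
  obtain ⟨A₁, h₁⟩ := runs_readHeader s p q t
  obtain ⟨A₂, h₂⟩ := runs_readClauses (s := s) D
  obtain ⟨A₃, h₃⟩ := exists_length_pathVertices_le D s
  let R₀ := q + 2 * t + A₃ + 1
  let T₁ := A₁ + A₂ * (R₀ + 1)
  refine ⟨T₁ + 4 * R₀ + 2 * T₁ + 6, fun φ => ?_⟩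
  set N := φ.encode.length with hN
  set b := modSize q p t φ.n with hb
  set V := φ.pathVertices D with hV
  have hlen : φ.n + 1 + (φ.clauses.length + 1) ≤ N := by
    have := length_listWord (listWord litWord) φ.clauses
    have e : N = (unaryWord φ.n).length + (listWord (listWord litWord) φ.clauses).length :=
      List.length_append
    have e' : (unaryWord φ.n).length = φ.n + 1 := by simp [unaryWord]
    omega
  have hp : φ.n / p ≤ φ.n := Nat.div_le_self _ _
  have htp : t * (φ.n / p) ≤ t * N := Nat.mul_le_mul_left _ (by omega)
  have hVN : V.length ≤ A₃ * N := (h₃ φ).trans (Nat.mul_le_mul_left _ (by omega))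
  have hR : b + V.length + N ≤ R₀ * N := by
    have h : q ≤ q * N := Nat.le_mul_of_pos_right _ (by omega)
    have h' : t ≤ t * N := Nat.le_mul_of_pos_right _ (by omega)
    have e : R₀ * N = q * N + 2 * (t * N) + A₃ * N + N := by simp only [R₀]; ring
    rw [hb, modSize, e, Nat.mul_add]
    omega
  obtain ⟨x, hx⟩ := h₂ φ.n φ.clauses φ.size_le (Fin.ofNat p φ.n) [] (paletteEdges q) b 0 V
    (R₀ * N) rfl (by omega) (by omega) (by
      rw [hb, modSize, Nat.mul_add] at hR
      omega)
  rw [List.append_nil, Nat.add_zero, Nat.zero_add] at hx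
  have hfirst : Runs (seq (readHeader q t) (readClauses D s)) (single 0 .inp φ.encode) _
      (T₁ * N ^ 2) := ((h₁ φ.n 0 _).seq hx).mono (by
    have e₁ : A₁ * (φ.n + 1) ≤ A₁ * N ^ 2 := Nat.mul_le_mul_left _ (by nlinarith)
    have e₂ : (φ.clauses.length + 1) * (A₂ * (R₀ * N + 1)) ≤ N * (A₂ * ((R₀ + 1) * N)) := by
      gcongr
      · omega
      · rw [Nat.add_mul R₀]; omega
    calc _ ≤ A₁ * N ^ 2 + N * (A₂ * ((R₀ + 1) * N)) := Nat.add_le_add e₁ e₂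
      _ = T₁ * N ^ 2 := by simp only [T₁]; ring)
  have hE : (listWord edgeWord (φ.kvEdges D)).length ≤ T₁ * N ^ 2 := by
    obtain ⟨u, hu, h⟩ := hfirst
    -- what has been written is no longer than the time it took
    have := h.length_le Reg.edges
    change _ ≤ 0 + u at this
    rw [Nat.zero_add] at this
    exact this.trans hu
  have hlast := runs_writeOutput (s := s) x (φ.kvEdges D) b V.length
  have henc : (φ.kvInstance D hq).encode = unaryWord (b + V.length) ++
      listWord edgeWord (φ.kvEdges D) ++
        (List.replicate b true ++ List.replicate V.length false) := by
    rw [kvInstance, listInstance_encode (Nat.le_add_right _ _), Nat.add_sub_cancel_left]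
  rw [henc]
  refine (hfirst.seq hlast).mono ?_
  have e₁ : 4 * (b + V.length) ≤ 4 * R₀ * N ^ 2 := by
    have : R₀ * N ≤ R₀ * N ^ 2 := Nat.mul_le_mul_left _ (by nlinarith)
    nlinarith
  have e₂ : 1 ≤ N ^ 2 := Nat.one_le_pow _ _ (by omega)
  nlinarith

end StackProg

/-! ### The lower bound -/

theorem ParamProblem.SolvableInOStar.mono {P : ParamProblem} {b b' : ℝ} (h : P.SolvableInOStar b)
    (hb : 0 ≤ b) (hbb : b ≤ b') : P.SolvableInOStar b' := by
  obtain ⟨M, C, c, hM⟩ := h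
  refine ⟨M, C, c, fun x => ?_⟩
  obtain ⟨t, ht, hout⟩ := hM x
  exact ⟨t, ht.trans (by gcongr), hout⟩

/-- No machine halts in zero steps, so a problem with an instance of parameter `1` is not solvable in
time `O*(b ^ k)` for `b ≤ 0`. -/
theorem not_solvableInOStar_of_nonpos {P : ParamProblem} {b : ℝ} (hb : b ≤ 0) (x : P.Inst)
    (hx : P.param x = 1) : ¬ P.SolvableInOStar b := by
  rintro ⟨M, C, c, hM⟩
  obtain ⟨t, ht, ⟨⟨n, hn⟩, hnt⟩⟩ := hM x
  have ht0 : (t : ℝ) ≤ 0 := ht.trans (by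
    rw [hx, pow_one]
    exact mul_nonpos_of_nonpos_of_nonneg (mul_nonpos_of_nonneg_of_nonpos (Nat.cast_nonneg _) hb)
      (by positivity))
  have ht0 : t = 0 := Nat.le_zero.1 (by exact_mod_cast ht0)
  obtain rfl : n = 0 := Nat.le_zero.1 (ht0 ▸ hnt)
  have h : some (Turing.initList M.tm _) = some (Turing.haltList M.tm _) := hn
  have := congrArg Turing.TM2.Cfg.l (Option.some.inj h)
  simp [Turing.initList, Turing.haltList] at this

/-- A block of `t` vertices with `q` colours can encode `p` variables, at a cost of less than `2 ^ p`
in terms of a base `b < q`. -/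
theorem exists_block_size {q : ℕ} {b : ℝ} (hb : 1 < b) (hbq : b < q) :
    ∃ t p : ℕ, 0 < t ∧ 0 < p ∧ b ^ t < 2 ^ p ∧ 2 ^ p ≤ q ^ t := by
  have hb0 : 0 < b := one_pos.trans hb
  obtain ⟨t, ht⟩ := pow_unbounded_of_one_lt 2 ((one_lt_div hb0).2 hbq)
  rw [div_pow, lt_div_iff₀ (by positivity)] at ht
  obtain ⟨n, hn, hn'⟩ := exists_nat_pow_near (one_le_pow₀ hb.le : 1 ≤ b ^ t) one_lt_two
  refine ⟨t, n + 1, ?_, n.succ_pos, hn', ?_⟩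
  · rcases Nat.eq_zero_or_pos t with rfl | h
    · norm_num at ht
    · exact h
  · have : (2 : ℝ) ^ (n + 1) ≤ (q : ℝ) ^ t := by rw [pow_succ]; linarith
    exact_mod_cast this

theorem mainTheorem4 (q : ℕ) (hq : 3 ≤ q) (ε : ℝ) (hε : 0 < ε) (hSETH : SETH) :
    ¬ (coloringProblem IsLinearForest q).SolvableInOStar ((q : ℝ) - ε) := by
  rcases le_or_gt ((q : ℝ) - ε) 0 with hneg | hpos
  · exact not_solvableInOStar_of_nonpos hneg
      (listInstance 1 1 [] (by simp) (by simp) (by simp)) (listInstance_card le_rfl)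
  intro hsolv
  have hq' : (3 : ℝ) ≤ q := by exact_mod_cast hq
  set b : ℝ := max (q - ε) 2 with hb
  have hb1 : 1 < b := one_lt_two.trans_le (le_max_right _ _)
  have hbq : b < q := max_lt (by linarith) (by linarith)
  replace hsolv := hsolv.mono hpos.le (le_max_left _ 2)
  obtain ⟨t, p, ht, hp, hbt, hpt⟩ := exists_block_size hb1 hbq
  have : NeZero p := ⟨hp.ne'⟩
  obtain ⟨e⟩ : Nonempty ((Fin p → Bool) ↪ (Fin t → Fin q)) :=
    Function.Embedding.nonempty_of_card_le (by simpa using hpt)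
  -- a left inverse of an embedding is a surjection that decodes colourings to assignments
  have hD := Function.invFun_surjective e.injective
  set D := Function.invFun e
  -- `β ^ p = b ^ t`: the base `b` per modulator vertex is the base `β < 2` per variable
  set β : ℝ := (b ^ t) ^ ((p : ℝ)⁻¹) with hβ
  have hbt1 : 1 ≤ b ^ t := one_le_pow₀ hb1.le
  have hβp : β ^ p = b ^ t := Real.rpow_inv_natCast_pow (zero_le_one.trans hbt1) hp.ne'
  have hβ1 : 1 ≤ β := Real.one_le_rpow hbt1 (by positivity)
  have hβ2 : β < 2 := lt_of_pow_lt_pow_left₀ p zero_le_two (hβp ▸ hbt)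
  obtain ⟨s, hs⟩ := hSETH (2 - β) (by linarith)
  rw [sub_sub_cancel] at hs
  obtain ⟨T, hT⟩ := StackProg.runs_reduction D s hq
  refine hs (StackProg.solvableInOStar_of_runs hβ1 (StackProg.reduction D s) (inp := .inp)
    (out := .out) (by simp) 0 T ⌈b ^ (q + t)⌉₊ (fun φ => ?_) (fun φ => ?_) hsolv)
  · exact List.append_ne_nil_of_left_ne_nil (by simp [unaryWord]) _
  · refine ⟨φ.kvInstance D hq, (φ.kvInstance_colorable_iff D hq hD ht).symm, ?_, hT φ⟩
    have hX : (φ.kvInstance D hq).X.card = BoundedCNF.modSize q p t φ.n :=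
      listInstance_card (Nat.le_add_right _ _)
    change b ^ (φ.kvInstance D hq).X.card ≤ ⌈b ^ (q + t)⌉₊ * β ^ φ.n
    rw [hX]
    calc b ^ BoundedCNF.modSize q p t φ.n = b ^ (q + t) * (b ^ t) ^ (φ.n / p) := by
          rw [← pow_mul, ← pow_add, BoundedCNF.modSize]
          congr 1
          ring
      _ = b ^ (q + t) * β ^ (p * (φ.n / p)) := by rw [← hβp, ← pow_mul]
      _ ≤ ⌈b ^ (q + t)⌉₊ * β ^ φ.n := by
          gcongr
          · exact Nat.le_ceil _
          · exact Nat.mul_div_le _ _
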